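/- **Setting.** Let $\mathcal C\subseteq[0,1]^n$ be a convex set containing $\mathbf 0$ that is down-closed (there is $\underline{\mathbf u}\in\mathcal C$ with $\underline{\mathbf u}\le\mathbf y$ for all $\mathbf y\in\mathcal C$, and every $\mathbf x$ with $\underline{\mathbf u}\le\mathbf x\le\mathbf y$ for some $\mathbf y\in\mathcal C$ lies in $\mathcal C$). Put $r(\mathcal C)=\sup_{\mathbf x\in\mathcal C}\|\mathbf x\|$ and $\mathrm{diam}(\mathcal C)=\sup_{\mathbf x,\mathbf y\in\mathcal C}\|\mathbf x-\mathbf y\|$. Let $T=QK$ with integers $Q,K\ge1$, and let $f_1,\dots,f_T:[0,1]^n\to[0,\infty)$ be fixed differentiable functions that are DR-submodular ($\nabla f_t(\mathbf x)\le\nabla f_t(\mathbf y)$ whenever $\mathbf x\ge\mathbf y$) and $L_0$-smooth ($\|\nabla f_t(\mathbf x)-\nabla f_t(\mathbf y)\|\le L_0\|\mathbf x-\mathbf y\|$ on $[0,1]^n$), with $\|\nabla f_t(\mathbf x)\|\le G$ for all $\mathbf x\in\mathcal C$. For each $t$ there is a stochastic gradient oracle $\widetilde\nabla f_t$ such that,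 for each $\mathbf x\in[0,1]^n$, $\mathbb E\,\widetilde\nabla f_t(\mathbf x)=\nabla f_t(\mathbf x)$ and $\mathbb E\|\nabla f_t(\mathbf x)-\widetilde\nabla f_t(\mathbf x)\|^2\le\sigma^2$. **Algorithm (Mono-MFW).** Let $\mathcal E^{(1)},\dots,\mathcal E^{(K)}$ be (possibly randomized) online linear maximization algorithms over $\mathcal C$. Let $\eta_k=\frac{2}{(k+3)^{2/3}}$ for $1\le k\le\frac K2+1$ and $\eta_k=\frac{1.5}{(K-k+2)^{2/3}}$ for $\frac K2+1<k\le K$. For $q=1,\dots,Q$: put $\mathbf x_q^{(0)}=\mathbf g_q^{(0)}=\mathbf 0$; for $k=1,\dots,K$ let $\mathbf v_q^{(k)}\in\mathcal C$ be the current action of $\mathcal E^{(k)}$ and $$\mathbf x_q^{(k)}=\mathbf x_q^{(k-1)}+\tfrac1K\,\mathbf v_q^{(k)}\odot(\mathbf 1-\mathbf x_q^{(k-1)});$$ draw a uniformly random permutation $(t_q^{(1)},\dots,t_q^{(K)})$ of $\{(q-1)K+1,\dots,qK\}$; play $\mathbf y_t=\mathbf x_q^{(K)}$ in every round $t\in\{(q-1)K+1,\dots,qK\}$;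 and for $k=1,\dots,K$ put $$\mathbf g_q^{(k)}=(1-\eta_k)\,\mathbf g_q^{(k-1)}+\eta_k\,\widetilde\nabla f_{t_q^{(k)}}(\mathbf x_q^{(k)})$$ and feed $\mathcal E^{(k)}$ the linear reward $\mathbf v\mapsto\langle(\mathbf 1-\mathbf x_q^{(k)})\odot\mathbf g_q^{(k)},\mathbf v\rangle$. So each $f_t$ is used for exactly one stochastic gradient evaluation. The gradient noises of the different $f_t$, the permutations of the different blocks and the internal randomness of the oracles are mutually independent. Assume that for some $M_0\ge0$ every oracle has expected regret at most $M_0\sqrt m$ at every horizon $m\le Q$ on the rewards it receives: for all $k\in\{1,\dots,K\}$, $m\le Q$ and $\mathbf u\in\mathcal C$, $$\mathbb E\sum_{q=1}^m\big\langle(\mathbf 1-\mathbf x_q^{(k)})\odot\mathbf g_q^{(k)},\,\mathbf u-\mathbf v_q^{(k)}\big\rangle\le M_0\sqrt m .$$ **Theorem 2.** The expected rewards $\mathbb E f_t(\mathbf y_t)$ are finite and $$\frac1e\sup_{\mathbf x\in\mathcal C}\sum_{t=1}^Tf_t(\mathbf x)-\sum_{t=1}^T\mathbb E f_t(\mathbf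 y_t)\le 2\,\mathrm{diam}(\mathcal C)(N_1+1)QK^{2/3}+\frac{L_0r^2(\mathcal C)}2Q+M_0\sqrt Q\,K,$$ where $$N_1=\max\Big\{5^{2/3}G^2,\ 8(\sigma^2+G^2)+32(2G+L_0r(\mathcal C))^2,\ 4.5(\sigma^2+G^2)+\tfrac73(2G+L_0r(\mathcal C))^2\Big\}.$$ In particular, if $K=T^{3/5}$ and $Q=T^{2/5}$, then the expected $1/e$-regret on the left is at most $\big(2\,\mathrm{diam}(\mathcal C)(N_1+1)+\tfrac12L_0r^2(\mathcal C)+M_0\big)T^{4/5}=O(T^{4/5})$. -/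

import Mathlib

open MeasureTheory ProbabilityTheory

noncomputable section

namespace MonoMFW

/-- The space `ℝⁿ` with its Euclidean norm. -/
abbrev Vec (n : ℕ) := EuclideanSpace ℝ (Fin n)

/-- The cube `[0,1]ⁿ`. -/
def box (n : ℕ) : Set (Vec n) := {x | ∀ i, 0 ≤ x i ∧ x i ≤ 1}

/-- The all-ones vector. -/
def ones (n : ℕ) : Vec n := WithLp.toLp 2 fun _ => 1

/-- Coordinate-wise product `x ⊙ y`. -/
def hadamard {n : ℕ} (x y : Vec n) : Vec n := WithLp.toLp 2 fun i => x i * y i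

/-- Down-closedness: there is a lower vector `u ∈ C` with `u ≤ y` for every `y ∈ C`, and every `x`
with `u ≤ x ≤ y` for some `y ∈ C` belongs to `C`. -/
def IsDownClosed {n : ℕ} (C : Set (Vec n)) : Prop :=
  ∃ u ∈ C, (∀ y ∈ C, ∀ i, u i ≤ y i) ∧
    ∀ x : Vec n, (∃ y ∈ C, (∀ i, u i ≤ x i) ∧ ∀ i, x i ≤ y i) → x ∈ C

/-- The radius `r(C) = sup_{x ∈ C} ‖x‖`. -/
def radius {n : ℕ} (C : Set (Vec n)) : ℝ := sSup ((fun x => ‖x‖) '' C)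

/-- The gradient of a function on the cube (one-sided at the boundary of the cube). -/
def grad {n : ℕ} (f : Vec n → ℝ) (x : Vec n) : Vec n := gradientWithin f (box n) x

/-- Gradient characterization of (continuous) DR-submodularity on the cube:
`x ≥ y` implies `∇f(x) ≤ ∇f(y)`. -/
def IsDRSubmodular {n : ℕ} (f : Vec n → ℝ) : Prop :=
  ∀ x ∈ box n, ∀ y ∈ box n, (∀ i, y i ≤ x i) → ∀ i, grad f x i ≤ grad f y i

/-- `L`-smoothness on the cube. -/
def IsSmooth {n : ℕ} (L : ℝ) (f : Vec n → ℝ) : Prop :=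
  ∀ x ∈ box n, ∀ y ∈ box n, ‖grad f x - grad f y‖ ≤ L * ‖x - y‖

/-- The two-phase step size `η_k`, for `1 ≤ k ≤ K`. -/
def stepSize (K k : ℕ) : ℝ :=
  if (k : ℝ) ≤ (K : ℝ) / 2 + 1 then 2 / ((k : ℝ) + 3) ^ (2 / 3 : ℝ)
  else 1.5 / ((K : ℝ) - k + 2) ^ (2 / 3 : ℝ)

/-- The points `x^(0), …, x^(K)` of one block, from the directions `v^(1), …, v^(K)`
(`v k` is `v^(k+1)`): `x^(0) = 0`, `x^(k) = x^(k-1) + (1/K) v^(k) ⊙ (1 - x^(k-1))`. -/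
def blockPoint {n K : ℕ} (v : Fin K → Vec n) : ℕ → Vec n
  | 0 => 0
  | k + 1 =>
    if h : k < K then
      blockPoint v k + (1 / (K : ℝ)) • hadamard (v ⟨k, h⟩) (ones n - blockPoint v k)
    else blockPoint v k

/-- The averaged gradients `g^(0), …, g^(K)` of one block, from the `K` gradient estimates
(`e k` is the estimate queried at `x^(k+1)`): `g^(0) = 0`,
`g^(k) = (1 - η_k) g^(k-1) + η_k e^(k)`. -/
def blockGrad {n K : ℕ} (e : Fin K → Vec n) : ℕ → Vec n
  | 0 => 0
  | k + 1 =>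
    if h : k < K then
      (1 - stepSize K (k + 1)) • blockGrad e k + stepSize K (k + 1) • e ⟨k, h⟩
    else blockGrad e k

/-- An online linear maximization algorithm with internal randomness in `S`: given the seed and the
`q` reward vectors received so far, it outputs its next action. -/
abbrev LinearOracle (S : Type*) (n : ℕ) := S → (q : ℕ) → (Fin q → Vec n) → Vec n

section Algorithm

variable {n K : ℕ} {S : Type*}

/-- The reward vectors that the `K` oracles have received before block `q` (blocks and rounds are
numbered from `0`; oracle `k : Fin K` is the `(k+1)`-st one). Here `s` is the realized seed of the
oracles, `sgrad t x` the realized stochastic gradient of `f_t` at `x`, and `perm q` the realized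
permutation of block `q`, so that `t_q^(k+1) = q * K + perm q k`. In block `q` the oracle `k + 1`
receives the vector `(1 - x_q^(k+1)) ⊙ g_q^(k+1)`. -/
def history (O : Fin K → LinearOracle S n) (s : S) (sgrad : ℕ → Vec n → Vec n)
    (perm : ℕ → Equiv.Perm (Fin K)) : (q : ℕ) → Fin K → Fin q → Vec n
  | 0 => fun _ i => i.elim0
  | q + 1 => fun k =>
    let v : Fin K → Vec n := fun j => O j s q (history O s sgrad perm q j)
    let e : Fin K → Vec n := fun j => sgrad (q * K + perm q j) (blockPoint v (j + 1))
    Fin.snoc (α := fun _ => Vec n) (history O s sgrad perm q k)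
      (hadamard (ones n - blockPoint v (k + 1)) (blockGrad e (k + 1)))

/-- The update direction `v_q^(k+1)`: the action of oracle `k` in block `q`. -/
def direction (O : Fin K → LinearOracle S n) (s : S) (sgrad : ℕ → Vec n → Vec n)
    (perm : ℕ → Equiv.Perm (Fin K)) (q : ℕ) (k : Fin K) : Vec n :=
  O k s q (history O s sgrad perm q k)

/-- The point `x_q^(k)`, for `0 ≤ k ≤ K`. -/
def point (O : Fin K → LinearOracle S n) (s : S) (sgrad : ℕ → Vec n → Vec n)
    (perm : ℕ → Equiv.Perm (Fin K)) (q k : ℕ) : Vec n :=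
  blockPoint (direction O s sgrad perm q) k

/-- The reward vector `(1 - x_q^(k+1)) ⊙ g_q^(k+1)` fed to oracle `k` at the end of block `q`. -/
def feedback (O : Fin K → LinearOracle S n) (s : S) (sgrad : ℕ → Vec n → Vec n)
    (perm : ℕ → Equiv.Perm (Fin K)) (q : ℕ) (k : Fin K) : Vec n :=
  history O s sgrad perm (q + 1) k (Fin.last q)

/-- The point `y_t = x_q^(K)` played in every round `t` of block `q = t / K`. -/
def play (O : Fin K → LinearOracle S n) (s : S) (sgrad : ℕ → Vec n → Vec n)
    (perm : ℕ → Equiv.Perm (Fin K)) (t : ℕ) : Vec n :=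
  point O s sgrad perm (t / K) K

end Algorithm

/-- Every set of permutations is measurable. -/
instance permMeasurableSpace (K : ℕ) : MeasurableSpace (Equiv.Perm (Fin K)) := ⊤

section Probability

variable {Ω S Ξ : Type*} [MeasurableSpace Ω] [MeasurableSpace S] [MeasurableSpace Ξ]

/-- The sources of randomness of a run with `Q` blocks of size `K`: the oracles' seed `ζ`, the noise
`ξ t` of the gradient oracle of `f_t`, and a uniformly random permutation `perm q` for each block,
all mutually independent. -/
structure IndependentRandomness (P : Measure Ω) (Q K : ℕ) (ζ : Ω → S) (ξ : ℕ → Ω → Ξ)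
    (perm : ℕ → Ω → Equiv.Perm (Fin K)) : Prop where
  measurable_seed : Measurable ζ
  measurable_noise : ∀ t < Q * K, Measurable (ξ t)
  measurable_perm : ∀ q < Q, Measurable (perm q)
  perm_uniform : ∀ q < Q, ∀ s : Equiv.Perm (Fin K),
    P {ω | perm q ω = s} = ((K.factorial : ℕ) : ENNReal)⁻¹
  noise_indep : iIndepFun (fun (t : Fin (Q * K)) ω => ξ t ω) P
  perm_indep : iIndepFun (fun (q : Fin Q) ω => perm q ω) P
  noise_perm_indep : IndepFun (fun ω (t : Fin (Q * K)) => ξ t ω) (fun ω (q : Fin Q) => perm q ω) P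
  seed_indep : IndepFun ζ
    (fun ω => ((fun t : Fin (Q * K) => ξ t ω), (fun q : Fin Q => perm q ω))) P

/-- `sg x (ξ ω)` is, for each fixed point `x` of the cube, a square-integrable unbiased estimate of
`∇f(x)` with variance at most `σ²`. -/
structure IsStochasticGradient {n : ℕ} (P : Measure Ω) (f : Vec n → ℝ) (σ : ℝ)
    (sg : Vec n → Ξ → Vec n) (ξ : Ω → Ξ) : Prop where
  measurable : Measurable (fun p : Vec n × Ξ => sg p.1 p.2)
  memLp : ∀ x ∈ box n, MemLp (fun ω => sg x (ξ ω)) 2 P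
  unbiased : ∀ x ∈ box n, ∫ ω, sg x (ξ ω) ∂P = grad f x
  variance_le : ∀ x ∈ box n, ∫ ω, ‖grad f x - sg x (ξ ω)‖ ^ 2 ∂P ≤ σ ^ 2

/-- The expected `α`-regret `α max_{x ∈ C} ∑_t f_t(x) - ∑_t E f_t(y_t)` over `T` rounds. -/
def expectedRegret {n : ℕ} (P : Measure Ω) (α : ℝ) (C : Set (Vec n)) (T : ℕ)
    (f : ℕ → Vec n → ℝ) (y : ℕ → Ω → Vec n) : ℝ :=
  α * sSup ((fun x => ∑ t ∈ Finset.range T, f t x) '' C) -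
    ∑ t ∈ Finset.range T, ∫ ω, f t (y t ω) ∂P

end Probability

/-- The constant `N₁`, as a function of `G`, `σ`, `L₀` and `r = r(C)`. -/
def constN (G σ L r : ℝ) : ℝ :=
  max ((5 : ℝ) ^ (2 / 3 : ℝ) * G ^ 2)
    (max (8 * (σ ^ 2 + G ^ 2) + 32 * (2 * G + L * r) ^ 2)
      (4.5 * (σ ^ 2 + G ^ 2) + 7 * (2 * G + L * r) ^ 2 / 3))

end MonoMFW

end

open MonoMFW

/-! The proof separates a deterministic estimate for one block from a single use of the randomness.

Deterministic part. DR-submodularity makes each reward concave along nonnegative directions. Since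
`1 - x^(k) ≥ (1 - 1/K)^k` coordinatewise, moving from `x^(k)` to `x^(k) + u ⊙ (1 - x^(k))` leaves a
value of at least `(1 - 1/K)^k f u` (`mul_le_apply_probSum`). Hence `f (x^(k))` satisfies a linear
recursion (`blockPoint_step`), whose solution gives `f u / e` minus the weighted linear regrets and
an error of order `1/K` (`blockPoint_regret`). Replacing the mean gradients by their running
averages costs `O(K^(2/3))` per block: the averages are fed the exact means, whose total variation
is at most `L r`, and every step size is at least `1 / (2 K^(2/3))` (`sum_norm_sub_blockGrad_le`,
`block_regret`).

Probabilistic part. All directions, hence all points, of block `q` are fixed by the seed and the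
earlier blocks, so they are independent of the noise and permutation of block `q`
(`IndependentRandomness.indepFun_direction`). Each position of the permutation is uniform, so each
estimate is unbiased for the mean gradient of the block. The averaged gradient is linear in the
estimates and is paired with a vector known before the block; the expected linear reward is
therefore the one computed from exact mean gradients (`integral_feedback`). No variance term arises:
`σ` enters only through integrability, and `N₁` merely has to dominate a multiple of `2G + L₀ r`
(`three_mul_le_constN`). -/

namespace MonoMFW

/-! ### Coordinatewise algebra, and the geometry of the cube. -/

section Coordinates

variable {n : ℕ}

@[simp] theorem ones_apply (i : Fin n) : ones n i = 1 := rfl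

@[simp] theorem hadamard_apply (x y : Vec n) (i : Fin n) : hadamard x y i = x i * y i := rfl

theorem inner_eq_sum (x y : Vec n) : inner ℝ x y = ∑ i, x i * y i := by
  simp [PiLp.inner_apply, mul_comm]

theorem inner_hadamard (a g d : Vec n) :
    inner ℝ (hadamard a g) d = inner ℝ g (hadamard a d) := by
  simp only [inner_eq_sum, hadamard_apply]
  exact Finset.sum_congr rfl fun i _ => by ring

theorem norm_le_norm_of_abs_le {x y : Vec n} (h : ∀ i, |x i| ≤ |y i|) : ‖x‖ ≤ ‖y‖ := by
  rw [EuclideanSpace.norm_eq, EuclideanSpace.norm_eq]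
  refine Real.sqrt_le_sqrt (Finset.sum_le_sum fun i _ => ?_)
  simp only [Real.norm_eq_abs]
  exact pow_le_pow_left₀ (abs_nonneg _) (h i) 2

theorem norm_hadamard_le {a x : Vec n} {c : ℝ} (hc : 0 ≤ c) (ha : ∀ i, |a i| ≤ c) :
    ‖hadamard a x‖ ≤ c * ‖x‖ := by
  rw [← abs_of_nonneg hc, ← Real.norm_eq_abs, ← norm_smul]
  refine norm_le_norm_of_abs_le fun i => ?_
  simp only [hadamard_apply, PiLp.smul_apply, smul_eq_mul, abs_mul, abs_of_nonneg hc]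
  gcongr
  exact ha i

theorem inner_le_inner_of_le {x y d : Vec n} (hd : ∀ i, 0 ≤ d i) (h : ∀ i, x i ≤ y i) :
    inner ℝ x d ≤ inner ℝ y d := by
  simp only [inner_eq_sum]
  exact Finset.sum_le_sum fun i _ => mul_le_mul_of_nonneg_right (h i) (hd i)

theorem convex_box : Convex ℝ (box n) := by
  intro x hx y hy a b ha hb hab i
  simp only [PiLp.add_apply, PiLp.smul_apply, smul_eq_mul]
  have h1 := hx i
  have h2 := hy i
  constructor
  · nlinarith [mul_nonneg ha h1.1, mul_nonneg hb h2.1]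
  · nlinarith [mul_le_mul_of_nonneg_left h1.2 ha, mul_le_mul_of_nonneg_left h2.2 hb]

theorem isCompact_box : IsCompact (box n) := by
  have h : box n = (EuclideanSpace.equiv (Fin n) ℝ).toHomeomorph ⁻¹'
      (Set.univ.pi fun _ => Set.Icc (0 : ℝ) 1) := by
    ext x
    simp [box, Pi.le_def, forall_and]
  rw [h, Homeomorph.isCompact_preimage]
  exact isCompact_univ_pi fun _ => isCompact_Icc

theorem zero_mem_box : (0 : Vec n) ∈ box n := fun i => by simp

end Coordinates

/-! ### Consequences of DR-submodularity along monotone segments. -/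

section Gradient

variable {n : ℕ} {f : Vec n → ℝ}

theorem exists_inner_grad_eq_sub (hf : DifferentiableOn ℝ f (box n)) {x y : Vec n}
    (hx : x ∈ box n) (hy : y ∈ box n) :
    ∃ c ∈ Set.Ioo (0 : ℝ) 1, f y - f x = inner ℝ (grad f (x + c • (y - x))) (y - x) := by
  have hmem : Set.MapsTo (fun s : ℝ => x + s • (y - x)) (Set.Icc 0 1) (box n) := by
    intro s hs
    exact convex_box.add_smul_sub_mem hx hy hs
  have hder : ∀ s ∈ Set.Icc (0 : ℝ) 1, HasDerivWithinAt (f ∘ fun s : ℝ => x + s • (y - x))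
      (inner ℝ (grad f (x + s • (y - x))) (y - x)) (Set.Icc 0 1) s := by
    intro s hs
    have h1 := (hf _ (hmem hs)).hasGradientWithinAt
    rw [hasGradientWithinAt_iff_hasFDerivWithinAt] at h1
    have h2 : HasDerivWithinAt (fun s : ℝ => x + s • (y - x)) (y - x) (Set.Icc 0 1) s := by
      simpa using (((hasDerivAt_id s).smul_const (y - x)).const_add x).hasDerivWithinAt
    have h3 := HasFDerivWithinAt.comp_hasDerivWithinAt (f := fun s : ℝ => x + s • (y - x))
      s h1 h2 hmem
    simpa [grad] using h3
  obtain ⟨c, hc, h⟩ := exists_hasDerivAt_eq_slope (f ∘ fun s : ℝ => x + s • (y - x))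
    (fun s => inner ℝ (grad f (x + s • (y - x))) (y - x)) zero_lt_one
    (fun s hs => (hder s hs).continuousWithinAt)
    (fun s hs => (hder s (Set.Ioo_subset_Icc_self hs)).hasDerivAt (Icc_mem_nhds hs.1 hs.2))
  refine ⟨c, hc, ?_⟩
  rw [h]
  simp

/-- Half of the concavity along nonnegative directions: the mean-value point of the segment lies
below `y`, so its gradient dominates the one at `y`. In `sub_le_inner_grad` the same point is
compared with `x`. -/
theorem inner_grad_le_sub (hf : DifferentiableOn ℝ f (box n)) (hDR : IsDRSubmodular f)
    {x y : Vec n} (hx : x ∈ box n) (hy : y ∈ box n) (hxy : ∀ i, x i ≤ y i) :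
    inner ℝ (grad f y) (y - x) ≤ f y - f x := by
  obtain ⟨c, hc, h⟩ := exists_inner_grad_eq_sub hf hx hy
  rw [h]
  refine inner_le_inner_of_le (fun i => sub_nonneg.2 (hxy i)) (hDR y hy _
    (convex_box.add_smul_sub_mem hx hy ⟨hc.1.le, hc.2.le⟩) fun i => ?_)
  simp only [PiLp.add_apply, PiLp.smul_apply, PiLp.sub_apply, smul_eq_mul]
  nlinarith [hxy i, hc.2]

theorem sub_le_inner_grad (hf : DifferentiableOn ℝ f (box n)) (hDR : IsDRSubmodular f)
    {x y : Vec n} (hx : x ∈ box n) (hy : y ∈ box n) (hxy : ∀ i, x i ≤ y i) :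
    f y - f x ≤ inner ℝ (grad f x) (y - x) := by
  obtain ⟨c, hc, h⟩ := exists_inner_grad_eq_sub hf hx hy
  rw [h]
  refine inner_le_inner_of_le (fun i => sub_nonneg.2 (hxy i)) (hDR _
    (convex_box.add_smul_sub_mem hx hy ⟨hc.1.le, hc.2.le⟩) x hx fun i => ?_)
  simp only [PiLp.add_apply, PiLp.smul_apply, PiLp.sub_apply, smul_eq_mul]
  nlinarith [hxy i, hc.1]

/-- Moving from `u` to the probabilistic sum `x + u ⊙ (1 - x)` with a point whose coordinates are at
most `M` costs a nonnegative DR-submodular function at most a factor `1 - M`. -/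
theorem mul_le_apply_probSum (hf : DifferentiableOn ℝ f (box n)) (hDR : IsDRSubmodular f)
    (hnonneg : ∀ x ∈ box n, 0 ≤ f x) {x u : Vec n} (hx : x ∈ box n) (hu : u ∈ box n) {M : ℝ}
    (hM0 : 0 ≤ M) (hM1 : M ≤ 1) (hxM : ∀ i, x i ≤ M) :
    (1 - M) * f u ≤ f (x + hadamard u (ones n - x)) := by
  -- The case `M = 0` is split off because the auxiliary point `z` below involves `M⁻¹`.
  rcases hM0.eq_or_lt with rfl | hM
  · have hx0 : x = 0 := by
      ext i
      exact le_antisymm (hxM i) (hx i).1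
    have : x + hadamard u (ones n - x) = u := by
      ext i
      simp [hx0]
    rw [this]
    simp
  set w := x + hadamard u (ones n - x) with hw
  -- `z` prolongs the segment from `u` to `w` by the factor `1/M` without leaving the cube.
  -- Concavity on this segment gives `f w ≥ (1 - M) f u + M f z`, and the last term is nonnegative.
  set z := u + M⁻¹ • hadamard x (ones n - u) with hz
  have hwi : ∀ i, w i = u i + x i * (1 - u i) := fun i => by
    simp [hw]
    ring
  have hzi : ∀ i, z i = u i + (x i / M) * (1 - u i) := fun i => by
    simp [hz]
    ring
  have hq : ∀ i, 0 ≤ x i / M ∧ x i / M ≤ 1 := fun i =>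
    ⟨div_nonneg (hx i).1 hM.le, (div_le_one hM).2 (hxM i)⟩
  have hwbox : w ∈ box n := fun i => by
    rw [hwi]
    have h1 := hx i
    have h2 := hu i
    constructor
    · nlinarith [mul_nonneg h1.1 (sub_nonneg.2 h2.2)]
    · nlinarith [mul_nonneg (sub_nonneg.2 h1.2) (sub_nonneg.2 h2.2)]
  have hzbox : z ∈ box n := fun i => by
    rw [hzi]
    have h1 := hq i
    have h2 := hu i
    constructor
    · nlinarith [mul_nonneg h1.1 (sub_nonneg.2 h2.2)]
    · nlinarith [mul_nonneg (sub_nonneg.2 h1.2) (sub_nonneg.2 h2.2)]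
  have huw : ∀ i, u i ≤ w i := fun i => by
    rw [hwi]
    nlinarith [mul_nonneg (hx i).1 (sub_nonneg.2 (hu i).2)]
  have hxz : ∀ i, x i ≤ x i / M := fun i => by
    rw [le_div_iff₀ hM]
    nlinarith [(hx i).1]
  have hwz : ∀ i, w i ≤ z i := fun i => by
    rw [hwi, hzi]
    have := mul_le_mul_of_nonneg_right (hxz i) (sub_nonneg.2 (hu i).2)
    linarith
  have e1 : w - u = M • (z - u) := by
    ext i
    simp only [PiLp.sub_apply, PiLp.smul_apply, smul_eq_mul, hwi, hzi]
    field_simp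
    ring
  have e2 : z - w = (1 - M) • (z - u) := by
    rw [sub_smul, ← e1, one_smul]
    abel
  have h1 := inner_grad_le_sub hf hDR hu hwbox huw
  have h2 := sub_le_inner_grad hf hDR hwbox hzbox hwz
  rw [e1, inner_smul_right] at h1
  rw [e2, inner_smul_right] at h2
  have h3 := mul_le_mul_of_nonneg_left h1 (sub_nonneg.2 hM1)
  have h4 := mul_le_mul_of_nonneg_left h2 hM.le
  have h5 := mul_nonneg hM.le (hnonneg z hzbox)
  nlinarith

theorem continuousOn_grad {L : ℝ} (hL : IsSmooth L f) : ContinuousOn (grad f) (box n) := by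
  have : LipschitzOnWith (Real.toNNReal L) (grad f) (box n) := by
    refine LipschitzOnWith.of_dist_le_mul fun x hx y hy => ?_
    rw [dist_eq_norm, dist_eq_norm]
    refine (hL x hx y hy).trans ?_
    gcongr
    exact Real.le_coe_toNNReal L
  exact this.continuousOn

end Gradient

/-! ### The points generated within one block. -/

section BlockPoint

variable {n K : ℕ}

theorem blockPoint_succ (v : Fin K → Vec n) (k : Fin K) :
    blockPoint v (k + 1) =
      blockPoint v k + (1 / (K : ℝ)) • hadamard (v k) (ones n - blockPoint v k) := by
  simp [blockPoint]

/-- The update is multiplicative in `1 - x`; this is the source of the factor `(1 - 1/K)^k`. -/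
theorem one_sub_blockPoint_succ (v : Fin K → Vec n) (k : Fin K) (i : Fin n) :
    1 - blockPoint v (k + 1) i = (1 - blockPoint v k i) * (1 - v k i / K) := by
  rw [blockPoint_succ]
  simp
  ring

theorem one_sub_inv_nonneg (K : ℕ) : (0 : ℝ) ≤ 1 - 1 / K := by
  rcases K.eq_zero_or_pos with rfl | h
  · simp
  · rw [sub_nonneg, div_le_one (by positivity)]
    exact_mod_cast h

theorem one_sub_blockPoint_bounds {v : Fin K → Vec n} (hv : ∀ j, v j ∈ box n) (k : ℕ) (i : Fin n) :
    (1 - 1 / (K : ℝ)) ^ k ≤ 1 - blockPoint v k i ∧ 1 - blockPoint v k i ≤ 1 := by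
  have h0 := one_sub_inv_nonneg K
  have h1 : 1 - 1 / (K : ℝ) ≤ 1 := by
    have : (0 : ℝ) ≤ 1 / K := by positivity
    linarith
  induction k with
  | zero => simp [blockPoint]
  | succ k ih =>
    by_cases hk : k < K
    · have e := one_sub_blockPoint_succ v ⟨k, hk⟩ i
      simp only at e
      rw [e, pow_succ]
      have hvi := hv ⟨k, hk⟩ i
      have h2 : v ⟨k, hk⟩ i / K ≤ 1 / K := by
        gcongr
        exact hvi.2
      have h3 : 0 ≤ v ⟨k, hk⟩ i / K := div_nonneg hvi.1 (by positivity)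
      have hp : 0 ≤ (1 - 1 / (K : ℝ)) ^ k := pow_nonneg h0 k
      constructor
      · exact mul_le_mul ih.1 (by linarith) h0 (hp.trans ih.1)
      · exact mul_le_one₀ ih.2 (by linarith) (by linarith)
    · simp only [blockPoint, hk, dite_false]
      refine ⟨le_trans ?_ ih.1, ih.2⟩
      exact pow_le_pow_of_le_one h0 h1 (Nat.le_succ k)

theorem blockPoint_mem_box {v : Fin K → Vec n} (hv : ∀ j, v j ∈ box n) (k : ℕ) :
    blockPoint v k ∈ box n := fun i => by
  have h := one_sub_blockPoint_bounds hv k i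
  have := pow_nonneg (one_sub_inv_nonneg K) k
  constructor <;> linarith [h.1, h.2]

theorem blockPoint_le {v : Fin K → Vec n} (hv : ∀ j, v j ∈ box n) (k : Fin K) (i : Fin n) :
    blockPoint v k i ≤ blockPoint v (k + 1) i ∧
      blockPoint v (k + 1) i - blockPoint v k i ≤ 1 / K := by
  have h := blockPoint_mem_box hv k i
  have e : blockPoint v (k + 1) i - blockPoint v k i =
      1 / K * (v k i * (1 - blockPoint v k i)) := by
    rw [blockPoint_succ]
    simp
  have hvi := hv k i
  have h1 : v k i * (1 - blockPoint v k i) ≤ 1 := mul_le_one₀ hvi.2 (by linarith) (by linarith)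
  have h2 : 0 ≤ v k i * (1 - blockPoint v k i) := mul_nonneg hvi.1 (by linarith)
  have h3 : (0 : ℝ) ≤ 1 / K := by positivity
  constructor
  · nlinarith [mul_nonneg h3 h2]
  · nlinarith [mul_le_mul_of_nonneg_left h1 h3]

theorem norm_blockPoint_succ_sub_le {v : Fin K → Vec n} (hv : ∀ j, v j ∈ box n) (k : Fin K) :
    ‖blockPoint v (k + 1) - blockPoint v k‖ ≤ ‖v k‖ / K := by
  rw [blockPoint_succ, add_sub_cancel_left, norm_smul]
  have h : ‖hadamard (v k) (ones n - blockPoint v k)‖ ≤ ‖v k‖ := by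
    refine norm_le_norm_of_abs_le fun i => ?_
    have h := blockPoint_mem_box hv k i
    rw [hadamard_apply, abs_mul]
    refine mul_le_of_le_one_right (abs_nonneg _) ?_
    simp only [PiLp.sub_apply, ones_apply]
    rw [abs_le]
    constructor <;> linarith [h.1, h.2]
  rw [Real.norm_of_nonneg (by positivity), one_div, inv_mul_eq_div]
  gcongr

theorem blockPoint_mem {C : Set (Vec n)} (hCbox : C ⊆ box n) (hCconv : Convex ℝ C)
    (hCdown : IsDownClosed C) (hC0 : (0 : Vec n) ∈ C) {v : Fin K → Vec n} (hv : ∀ j, v j ∈ C)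
    {k : ℕ} (hk : k ≤ K) : blockPoint v k ∈ C := by
  have hvb : ∀ j, v j ∈ box n := fun j => hCbox (hv j)
  rcases K.eq_zero_or_pos with rfl | hK
  · obtain rfl : k = 0 := by omega
    exact hC0
  have hK' : (0 : ℝ) < K := by exact_mod_cast hK
  -- The witness `y` is the running mean of the directions used so far, which lies in `C` by
  -- convexity. Down-closedness then applies, the lower vector being at most `0` because `0 ∈ C`.
  have key : ∀ k ≤ K, ∃ y ∈ C, ∀ i, blockPoint v k i ≤ (k / K : ℝ) * y i := by
    intro k
    induction k with
    | zero => exact fun _ => ⟨0, hC0, fun i => by simp [blockPoint]⟩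
    | succ k ih =>
      intro hk
      obtain ⟨y, hy, h⟩ := ih (by omega)
      have hk1 : (0 : ℝ) < k + 1 := by positivity
      refine ⟨(k / (k + 1) : ℝ) • y + (1 / (k + 1) : ℝ) • v ⟨k, hk⟩,
        hCconv hy (hv _) (by positivity) (by positivity) (by field_simp), fun i => ?_⟩
      have e := congrArg (fun z : Vec n => z i) (blockPoint_succ v ⟨k, hk⟩)
      simp only [PiLp.add_apply, PiLp.smul_apply, hadamard_apply, PiLp.sub_apply, ones_apply,
        smul_eq_mul] at e ⊢
      rw [e]
      have h1 : v ⟨k, hk⟩ i * (1 - blockPoint v k i) ≤ v ⟨k, hk⟩ i := by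
        have := blockPoint_mem_box hvb k i
        nlinarith [(hvb ⟨k, hk⟩ i).1, this.1]
      have h2 : 1 / (K : ℝ) * (v ⟨k, hk⟩ i * (1 - blockPoint v k i)) ≤ 1 / K * v ⟨k, hk⟩ i := by
        gcongr
      calc _ ≤ (k / K : ℝ) * y i + 1 / K * v ⟨k, hk⟩ i := add_le_add (h i) h2
        _ = _ := by
          push_cast
          field_simp
  obtain ⟨y, hy, h⟩ := key k hk
  obtain ⟨u, hu, hul, hdown⟩ := hCdown
  refine hdown _ ⟨y, hy, fun i => ?_, fun i => (h i).trans ?_⟩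
  · exact (hul 0 hC0 i).trans (by simpa using (blockPoint_mem_box hvb k i).1)
  · refine mul_le_of_le_one_left (hCbox hy i).1 ((div_le_one hK').2 (by exact_mod_cast hk))

end BlockPoint

/-! ### Scalar recursions, step sizes and the tracking error. -/

section Recursion

/-- The gain of step `k` is discounted by `ρ ^ (m - 1 - k)` and already carries `ρ ^ k`, so all `m`
gains equal `κ ρ ^ (m - 1) c`. At `m = 0` the truncated exponent is harmless, being multiplied by
`m`. -/
theorem le_of_linear_recursion {ρ κ c : ℝ} (hρ : 0 ≤ ρ) {N : ℕ} (a e : ℕ → ℝ)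
    (h : ∀ k < N, ρ * a k + κ * ρ ^ k * c - κ * e k ≤ a (k + 1)) :
    ∀ m ≤ N, ρ ^ m * a 0 + κ * m * ρ ^ (m - 1) * c
      - κ * ∑ j ∈ Finset.range m, ρ ^ (m - 1 - j) * e j ≤ a m := by
  intro m
  induction m with
  | zero => simp
  | succ m ih =>
    intro hm
    have h1 := mul_le_mul_of_nonneg_left (ih (by omega)) hρ
    have h2 := h m (by omega)
    have e1 : ∑ j ∈ Finset.range (m + 1), ρ ^ (m + 1 - 1 - j) * e j =
        e m + ρ * ∑ j ∈ Finset.range m, ρ ^ (m - 1 - j) * e j := by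
      rw [Finset.sum_range_succ, add_comm, Finset.mul_sum]
      congr 1
      · simp
      · refine Finset.sum_congr rfl fun j hj => ?_
        have hj := Finset.mem_range.1 hj
        rw [show m + 1 - 1 - j = (m - 1 - j) + 1 by omega, pow_succ]
        ring
    have e2 : ρ * ((m : ℝ) * ρ ^ (m - 1)) = m * ρ ^ m := by
      cases m with
      | zero => simp
      | succ m => simp [pow_succ]; ring
    rw [e1]
    have e3 : ρ * (κ * m * ρ ^ (m - 1) * c) = κ * m * ρ ^ m * c := by
      rw [show ρ * (κ * m * ρ ^ (m - 1) * c) = κ * (ρ * ((m : ℝ) * ρ ^ (m - 1))) * c by ring, e2]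
      ring
    push_cast
    rw [pow_succ]
    nlinarith

/-- Telescoping bounds the sum of the errors by `(b 0 + m δ) / h`. The term in `b m` on the left is
what makes the induction close. -/
theorem mul_sum_le_of_contraction {h δ : ℝ} (h0 : 0 ≤ h) (hδ : 0 ≤ δ) {N : ℕ}
    (b : ℕ → ℝ) (hb0 : 0 ≤ b 0) (hb : ∀ k < N, b (k + 1) ≤ (1 - h) * (b k + δ)) :
    ∀ m ≤ N, h * ∑ k ∈ Finset.range m, b (k + 1) + (1 - h) * b m ≤ b 0 + m * δ := by
  intro m
  induction m with
  | zero => simpa using mul_le_of_le_one_left hb0 (by linarith)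
  | succ m ih =>
    intro hm
    have h2 := ih (by omega)
    have h3 := hb m (by omega)
    rw [Finset.sum_range_succ]
    push_cast
    nlinarith [mul_nonneg h0 hδ]

theorem exp_neg_one_le_pow (K : ℕ) (hK : 1 ≤ K) :
    1 / Real.exp 1 ≤ (1 - 1 / (K : ℝ)) ^ (K - 1) := by
  obtain ⟨m, rfl⟩ : ∃ m, K = m + 1 := ⟨K - 1, by omega⟩
  rcases m.eq_zero_or_pos with rfl | hm
  · simp [Real.one_le_exp_iff, inv_le_one_of_one_le₀]
  have hm' : (0 : ℝ) < m := by exact_mod_cast hm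
  have e : 1 - 1 / ((m + 1 : ℕ) : ℝ) = (1 + 1 / (m : ℝ))⁻¹ := by
    push_cast
    field_simp
    ring
  rw [e, Nat.add_sub_cancel, inv_pow, one_div]
  gcongr
  calc (1 + 1 / (m : ℝ)) ^ m ≤ Real.exp (1 / m) ^ m := by
        gcongr
        rw [add_comm]
        exact Real.add_one_le_exp _
    _ = Real.exp 1 := by
        rw [← Real.exp_nat_mul]
        congr 1
        field_simp

/-- All that the argument uses of the two-phase schedule: a contraction of at least `1 / (2
K^(2/3))`, and a nonnegative factor `1 - η`. -/
theorem stepSize_bounds {K k : ℕ} (hk : 1 ≤ k) (hkK : k ≤ K) :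
    1 / (2 * (K : ℝ) ^ (2 / 3 : ℝ)) ≤ stepSize K k ∧ stepSize K k ≤ 1 := by
  have hk' : (1 : ℝ) ≤ k := by exact_mod_cast hk
  have hkK' : (k : ℝ) ≤ K := by exact_mod_cast hkK
  have hKp : 0 < (K : ℝ) ^ (2 / 3 : ℝ) := Real.rpow_pos_of_pos (by linarith) _
  unfold stepSize
  split_ifs with h
  · have h2 : (2 : ℝ) ≤ ((k : ℝ) + 3) ^ (2 / 3 : ℝ) := by
      calc (2 : ℝ) = 4 ^ (1 / 2 : ℝ) := by
            rw [← Real.sqrt_eq_rpow, show (4 : ℝ) = 2 ^ 2 by norm_num]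
            exact (Real.sqrt_sq (by norm_num)).symm
        _ ≤ 4 ^ (2 / 3 : ℝ) := Real.rpow_le_rpow_of_exponent_le (by norm_num) (by norm_num)
        _ ≤ _ := Real.rpow_le_rpow (by norm_num) (by linarith) (by norm_num)
    have h3 : ((k : ℝ) + 3) ^ (2 / 3 : ℝ) ≤ 4 * (K : ℝ) ^ (2 / 3 : ℝ) := by
      calc ((k : ℝ) + 3) ^ (2 / 3 : ℝ) ≤ (4 * K) ^ (2 / 3 : ℝ) :=
            Real.rpow_le_rpow (by linarith) (by linarith) (by norm_num)
        _ = 4 ^ (2 / 3 : ℝ) * (K : ℝ) ^ (2 / 3 : ℝ) :=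
            Real.mul_rpow (by norm_num) (by linarith)
        _ ≤ _ := by
            gcongr
            exact Real.rpow_le_self_of_one_le (by norm_num) (by norm_num)
    constructor
    · rw [div_le_div_iff₀ (by positivity) (by positivity)]
      linarith
    · rw [div_le_one (by positivity)]
      exact h2
  · push Not at h
    have h2 : (1.5 : ℝ) ≤ ((K : ℝ) - k + 2) ^ (2 / 3 : ℝ) := by
      calc (1.5 : ℝ) = (1.5 ^ (3 / 2 : ℝ)) ^ (2 / 3 : ℝ) := by
            rw [← Real.rpow_mul (by norm_num)]
            norm_num
        _ ≤ 2 ^ (2 / 3 : ℝ) := by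
            refine Real.rpow_le_rpow (by positivity) ?_ (by norm_num)
            -- `1.5 ^ (3/2) = 1.5 √1.5 ≤ 1.5 · 1.3 < 2`.
            rw [show (3 / 2 : ℝ) = 1 + 1 / 2 by norm_num, Real.rpow_add (by norm_num),
              Real.rpow_one, ← Real.sqrt_eq_rpow]
            have : √(1.5 : ℝ) ≤ 1.3 := by
              rw [Real.sqrt_le_left (by norm_num)]
              norm_num
            linarith
        _ ≤ _ := Real.rpow_le_rpow (by norm_num) (by linarith) (by norm_num)
    have h3 : ((K : ℝ) - k + 2) ^ (2 / 3 : ℝ) ≤ (K : ℝ) ^ (2 / 3 : ℝ) := by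
      refine Real.rpow_le_rpow (by linarith) ?_ (by norm_num)
      -- The second phase starts beyond `K/2 + 1`, so `k ≥ 2` and `K - k + 2 ≤ K`.
      have : (2 : ℝ) ≤ k := by
        have h4 : (1 : ℝ) < k := by linarith
        have h5 : 1 < k := by exact_mod_cast h4
        exact_mod_cast h5
      linarith
    constructor
    · rw [div_le_div_iff₀ (by positivity) (by linarith)]
      linarith
    · rw [div_le_one (by linarith)]
      exact h2

theorem blockGrad_succ {n K : ℕ} (e : Fin K → Vec n) (k : Fin K) :
    blockGrad e (k + 1) =
      (1 - stepSize K (k + 1)) • blockGrad e k + stepSize K (k + 1) • e k := by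
  simp [blockGrad]

/-- The averaged gradients track a slowly moving sequence when they are fed its exact values. -/
theorem sum_norm_sub_blockGrad_le {n K : ℕ} (p : ℕ → Vec n) {G δ : ℝ} (hδ : 0 ≤ δ)
    (hp0 : ‖p 0‖ ≤ G) (hp : ∀ k < K, ‖p (k + 1) - p k‖ ≤ δ) :
    ∑ k : Fin K, ‖p (k + 1) - blockGrad (fun j : Fin K => p (j + 1)) (k + 1)‖ ≤
      2 * (K : ℝ) ^ (2 / 3 : ℝ) * (G + K * δ) := by
  rcases K.eq_zero_or_pos with rfl | hK
  · simp
  set e : Fin K → Vec n := fun j => p (j + 1) with he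
  have hK' : (1 : ℝ) ≤ K := by exact_mod_cast hK
  have hKp : 1 ≤ (K : ℝ) ^ (2 / 3 : ℝ) := Real.one_le_rpow hK' (by norm_num)
  have key := mul_sum_le_of_contraction (h := 1 / (2 * (K : ℝ) ^ (2 / 3 : ℝ))) (by positivity)
    hδ (N := K)
    (fun k => ‖p k - blockGrad e k‖) (norm_nonneg _) (fun k hk => ?_) K le_rfl
  · have h0 : ‖p 0 - blockGrad e 0‖ = ‖p 0‖ := by simp [blockGrad]
    simp only [h0] at key
    have hnn : 0 ≤ (1 - 1 / (2 * (K : ℝ) ^ (2 / 3 : ℝ))) * ‖p K - blockGrad e K‖ := by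
      refine mul_nonneg ?_ (norm_nonneg _)
      rw [sub_nonneg, div_le_one (by positivity)]
      linarith
    rw [Finset.sum_range fun k => ‖p (k + 1) - blockGrad e (k + 1)‖,
      one_div_mul_eq_div] at key
    have h2 := (le_add_of_nonneg_right hnn).trans key
    rw [div_le_iff₀ (by positivity)] at h2
    refine h2.trans ?_
    rw [mul_comm]
    gcongr
  · have hs := stepSize_bounds (K := K) (k := k + 1) (by omega) hk
    -- The newly fed value is the target `p (k + 1)` itself, so the old error and the drift of the
    -- target are both multiplied by `1 - η`.
    have e1 : p (k + 1) - blockGrad e (k + 1) =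
        (1 - stepSize K (k + 1)) • ((p k - blockGrad e k) + (p (k + 1) - p k)) := by
      have := blockGrad_succ e ⟨k, hk⟩
      simp only at this
      rw [this]
      simp only [he]
      module
    rw [e1, norm_smul, Real.norm_of_nonneg (by linarith)]
    refine mul_le_mul (by linarith [hs.1]) ((norm_add_le _ _).trans ?_) (norm_nonneg _) ?_
    · gcongr
      exact hp k hk
    · linarith [hs.1.trans hs.2]

end Recursion

/-! ### Deterministic regret of one block. -/

section Block

variable {n K : ℕ}

/-- One step gains at least `⟨∇f(y), y - x⟩`, with the gradient at the new point `y`, where the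
algorithm queries it. Exchanging `v k` for `u` produces the linear regret; concavity then compares
the result with `f u`. -/
theorem blockPoint_step {f : Vec n → ℝ} {L G r : ℝ} {C : Set (Vec n)} (hCbox : C ⊆ box n)
    (hCconv : Convex ℝ C) (hCdown : IsDownClosed C) (hC0 : (0 : Vec n) ∈ C)
    (hr : ∀ x ∈ C, ‖x‖ ≤ r)
    (hnonneg : ∀ x ∈ box n, 0 ≤ f x) (hf : DifferentiableOn ℝ f (box n)) (hDR : IsDRSubmodular f)
    (hL : 0 ≤ L) (hsmooth : IsSmooth L f) (hG : ∀ x ∈ C, ‖grad f x‖ ≤ G)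
    {v : Fin K → Vec n} (hv : ∀ j, v j ∈ C) {u : Vec n} (hu : u ∈ C) (k : Fin K) :
    (1 - 1 / (K : ℝ)) * f (blockPoint v k) + 1 / (K : ℝ) * (1 - 1 / (K : ℝ)) ^ (k : ℕ) * f u
      - 1 / (K : ℝ) * (inner ℝ (hadamard (ones n - blockPoint v (k + 1))
          (grad f (blockPoint v (k + 1)))) (u - v k) + (2 * G + L * r) * r / K)
      ≤ f (blockPoint v (k + 1)) := by
  have hK : 0 < K := k.pos
  have hK' : (0 : ℝ) < K := by exact_mod_cast hK
  have hvb : ∀ j, v j ∈ box n := fun j => hCbox (hv j)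
  have hub := hCbox hu
  have hrn : 0 ≤ r := (norm_nonneg _).trans (hr 0 hC0)
  have hGn : 0 ≤ G := (norm_nonneg _).trans (hG 0 hC0)
  have hx := blockPoint_mem_box hvb k
  have hy := blockPoint_mem_box hvb (k + 1)
  have hyC : blockPoint v (k + 1) ∈ C :=
    blockPoint_mem hCbox hCconv hCdown hC0 hv k.is_lt
  have hxy := fun i => blockPoint_le hvb k i
  have hbd := fun i => one_sub_blockPoint_bounds hvb k i
  have hstep := blockPoint_succ v k
  have hnorm := (norm_blockPoint_succ_sub_le hvb k).trans
    (div_le_div_of_nonneg_right (hr _ (hv k)) hK'.le)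
  set x := blockPoint v k
  set y := blockPoint v (k + 1)
  have hpq : ‖grad f y - grad f x‖ ≤ L * (r / K) :=
    (hsmooth y hy x hx).trans (mul_le_mul_of_nonneg_left hnorm hL)
  have h1 := inner_grad_le_sub hf hDR hx hy fun i => (hxy i).1
  have h2 := mul_le_apply_probSum hf hDR hnonneg hx hub
    (M := 1 - (1 - 1 / (K : ℝ)) ^ (k : ℕ))
    (by have := pow_le_one₀ (n := (k : ℕ)) (one_sub_inv_nonneg K)
          (by linarith [show (0 : ℝ) ≤ 1 / K by positivity])
        linarith)
    (by linarith [pow_nonneg (one_sub_inv_nonneg K) (k : ℕ)])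
    (fun i => by linarith [(hbd i).1])
  have hprob : x + hadamard u (ones n - x) ∈ box n := fun i => by
    simp only [PiLp.add_apply, hadamard_apply, PiLp.sub_apply, ones_apply]
    have a1 := hx i
    have a2 := hub i
    constructor
    · nlinarith [mul_nonneg a2.1 (sub_nonneg.2 a1.2)]
    · nlinarith [mul_nonneg (sub_nonneg.2 a2.2) (sub_nonneg.2 a1.2)]
  have h3 := sub_le_inner_grad hf hDR hx hprob fun i => by
    simp only [PiLp.add_apply, hadamard_apply, PiLp.sub_apply, ones_apply]
    nlinarith [mul_nonneg (hub i).1 (sub_nonneg.2 (hx i).2)]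
  rw [add_sub_cancel_left] at h3
  have e1 : inner ℝ (grad f y) (y - x) =
      1 / (K : ℝ) * inner ℝ (grad f y) (hadamard (v k) (ones n - x)) := by
    rw [hstep, add_sub_cancel_left, inner_smul_right]
  -- Besides the linear regret, this identity leaves three errors: two from replacing `1 - x` by `1
  -- - y`, of size `G r / K` each, and one from replacing `∇f(y)` by `∇f(x)`, of size `L r² / K`.
  -- They add up to `(2G + L r) r / K`.
  have e2 : inner ℝ (grad f y) (hadamard (v k) (ones n - x)) =
      inner ℝ (grad f x) (hadamard u (ones n - x))
        - inner ℝ (hadamard (ones n - y) (grad f y)) (u - v k)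
        + (inner ℝ (hadamard (x - y) (grad f y)) u
          + inner ℝ (hadamard (ones n - x) (grad f y - grad f x)) u)
        + inner ℝ (hadamard (y - x) (grad f y)) (v k) := by
    simp only [inner_eq_sum, hadamard_apply, PiLp.sub_apply, ones_apply,
      ← Finset.sum_add_distrib, ← Finset.sum_sub_distrib]
    exact Finset.sum_congr rfl fun i _ => by ring
  have habs : ∀ i, |(y - x) i| ≤ 1 / K := fun i => by
    rw [PiLp.sub_apply, abs_of_nonneg (by linarith [(hxy i).1])]
    exact (hxy i).2
  have b1 : ‖hadamard (x - y) (grad f y)‖ ≤ 1 / K * G := by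
    refine (norm_hadamard_le (c := 1 / (K : ℝ)) (by positivity) fun i => ?_).trans
      (by gcongr; exact hG y hyC)
    have := habs i
    rwa [PiLp.sub_apply, abs_sub_comm] at this
  have b2 : ‖hadamard (y - x) (grad f y)‖ ≤ 1 / K * G :=
    (norm_hadamard_le (by positivity) habs).trans (by gcongr; exact hG y hyC)
  have b3 : ‖hadamard (ones n - x) (grad f y - grad f x)‖ ≤ 1 * (L * (r / K)) :=
    (norm_hadamard_le zero_le_one fun i => by
      simp only [PiLp.sub_apply, ones_apply]
      rw [abs_le]
      constructor <;> linarith [(hx i).1, (hx i).2]).trans (by gcongr)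
  have cs : ∀ {a b : Vec n} {c : ℝ}, ‖a‖ ≤ c → ‖b‖ ≤ r → -(c * r) ≤ inner ℝ a b := by
    intro a b c ha hb
    have h := (abs_le.1 (abs_real_inner_le_norm a b)).1
    have : ‖a‖ * ‖b‖ ≤ c * r :=
      mul_le_mul ha hb (norm_nonneg _) ((norm_nonneg _).trans ha)
    linarith
  have c1 := cs b1 (hr u hu)
  have c2 := cs b2 (hr _ (hv k))
  have c3 := cs b3 (hr u hu)
  rw [e1, e2] at h1
  have e3 : (2 * G + L * r) * r / K = 1 / K * G * r + 1 / K * G * r + 1 * (L * (r / K)) * r := by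
    field_simp
    ring
  rw [e3]
  have hκ : (0 : ℝ) ≤ 1 / K := by positivity
  have h4 : (1 - 1 / (K : ℝ)) ^ (k : ℕ) * f u - f x
        - inner ℝ (hadamard (ones n - y) (grad f y)) (u - v k)
        - (1 / K * G * r + 1 / K * G * r + 1 * (L * (r / K)) * r) ≤
      (inner ℝ (grad f x) (hadamard u (ones n - x))
        - inner ℝ (hadamard (ones n - y) (grad f y)) (u - v k)
        + (inner ℝ (hadamard (x - y) (grad f y)) u
          + inner ℝ (hadamard (ones n - x) (grad f y - grad f x)) u)
        + inner ℝ (hadamard (y - x) (grad f y)) (v k)) := by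
    linarith
  have h5 := mul_le_mul_of_nonneg_left h4 hκ
  linarith

/-- `blockPoint_step` unrolled over the `K` steps, dropping the nonnegative contribution of `f 0`.
-/
theorem blockPoint_regret {f : Vec n → ℝ} {L G r : ℝ} {C : Set (Vec n)} (hCbox : C ⊆ box n)
    (hCconv : Convex ℝ C) (hCdown : IsDownClosed C) (hC0 : (0 : Vec n) ∈ C)
    (hr : ∀ x ∈ C, ‖x‖ ≤ r)
    (hnonneg : ∀ x ∈ box n, 0 ≤ f x) (hf : DifferentiableOn ℝ f (box n)) (hDR : IsDRSubmodular f)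
    (hL : 0 ≤ L) (hsmooth : IsSmooth L f) (hG : ∀ x ∈ C, ‖grad f x‖ ≤ G) (hK : 1 ≤ K)
    {v : Fin K → Vec n} (hv : ∀ j, v j ∈ C) {u : Vec n} (hu : u ∈ C) :
    1 / Real.exp 1 * f u - f (blockPoint v K) ≤
      1 / (K : ℝ) * ∑ k : Fin K, (1 - 1 / (K : ℝ)) ^ (K - 1 - (k : ℕ)) *
          inner ℝ (hadamard (ones n - blockPoint v (k + 1))
            (grad f (blockPoint v (k + 1)))) (u - v k)
        + (2 * G + L * r) * r / K := by
  have hK' : (0 : ℝ) < K := by exact_mod_cast hK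
  have hrn : 0 ≤ r := (norm_nonneg _).trans (hr 0 hC0)
  have hGn : 0 ≤ G := (norm_nonneg _).trans (hG 0 hC0)
  set ρ := 1 - 1 / (K : ℝ) with hρ
  have hρ0 : 0 ≤ ρ := one_sub_inv_nonneg K
  have hρ1 : ρ ≤ 1 := by
    have : (0 : ℝ) ≤ 1 / K := by positivity
    linarith
  set ε := (2 * G + L * r) * r / K with hε
  have hε0 : 0 ≤ ε := by positivity
  set R : Fin K → ℝ := fun k => inner ℝ (hadamard (ones n - blockPoint v (k + 1))
    (grad f (blockPoint v (k + 1)))) (u - v k) with hR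
  have key := le_of_linear_recursion (κ := 1 / (K : ℝ)) (c := f u) hρ0 (N := K)
    (fun k => f (blockPoint v k)) (fun k => if h : k < K then R ⟨k, h⟩ + ε else 0)
    (fun k hk => by
      simp only [hk, dite_true]
      exact blockPoint_step hCbox hCconv hCdown hC0 hr hnonneg hf hDR hL hsmooth hG hv hu ⟨k, hk⟩)
    K le_rfl
  rw [Finset.sum_range] at key
  simp only [Fin.is_lt, dite_true, Fin.eta, mul_add, Finset.sum_add_distrib] at key
  have h0 : 0 ≤ ρ ^ K * f (blockPoint v 0) :=
    mul_nonneg (pow_nonneg hρ0 _) (hnonneg _ zero_mem_box)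
  -- The exponent is `K - 1`: each of the `K` gains loses only `K - 1` factors. This keeps the
  -- coefficient at least `1/e`, which `(1 - 1/K) ^ K` would not be.
  have h1 : 1 / Real.exp 1 * f u ≤ 1 / (K : ℝ) * K * ρ ^ (K - 1) * f u := by
    rw [one_div_mul_cancel hK'.ne', one_mul]
    exact mul_le_mul_of_nonneg_right (exp_neg_one_le_pow K hK) (hnonneg u (hCbox hu))
  have h2 : 1 / (K : ℝ) * ∑ k : Fin K, ρ ^ (K - 1 - (k : ℕ)) * ε ≤ ε := by
    calc 1 / (K : ℝ) * ∑ k : Fin K, ρ ^ (K - 1 - (k : ℕ)) * ε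
        ≤ 1 / (K : ℝ) * ∑ k : Fin K, ε := by
          gcongr with k
          exact mul_le_of_le_one_left hε0 (pow_le_one₀ hρ0 hρ1)
      _ = ε := by
          simp
          field_simp
  linarith

/-- The deterministic regret bound of one block: up to the error of order `K ^ (2/3)` the regret is
the weighted regret of the `K` linear problems whose rewards average the exact mean gradients. -/
theorem block_regret {f : Fin K → Vec n → ℝ} {L G r D : ℝ} {C : Set (Vec n)} (hCbox : C ⊆ box n)
    (hCconv : Convex ℝ C) (hCdown : IsDownClosed C) (hC0 : (0 : Vec n) ∈ C)
    (hr : ∀ x ∈ C, ‖x‖ ≤ r) (hrD : r ≤ D) (hD : ∀ x ∈ C, ∀ y ∈ C, ‖x - y‖ ≤ D)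
    (hnonneg : ∀ i, ∀ x ∈ box n, 0 ≤ f i x) (hf : ∀ i, DifferentiableOn ℝ (f i) (box n))
    (hDR : ∀ i, IsDRSubmodular (f i))
    (hL : 0 ≤ L) (hsmooth : ∀ i, IsSmooth L (f i)) (hG : ∀ i, ∀ x ∈ C, ‖grad (f i) x‖ ≤ G)
    (hK : 1 ≤ K) {v : Fin K → Vec n} (hv : ∀ j, v j ∈ C) {u : Vec n} (hu : u ∈ C) :
    ∑ i, (1 / Real.exp 1 * f i u - f i (blockPoint v K)) ≤
      ∑ k : Fin K, (1 - 1 / (K : ℝ)) ^ (K - 1 - (k : ℕ)) *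
          inner ℝ (hadamard (ones n - blockPoint v (k + 1))
            (blockGrad (fun j : Fin K => (1 / (K : ℝ)) • ∑ i, grad (f i) (blockPoint v (j + 1)))
              (k + 1))) (u - v k)
        + 3 * (2 * G + L * r) * D * (K : ℝ) ^ (2 / 3 : ℝ) := by
  have hK' : (0 : ℝ) < K := by exact_mod_cast hK
  have hK1 : (1 : ℝ) ≤ K := by exact_mod_cast hK
  have hvb : ∀ j, v j ∈ box n := fun j => hCbox (hv j)
  have hrn : 0 ≤ r := (norm_nonneg _).trans (hr 0 hC0)
  have hGn : 0 ≤ G := (norm_nonneg _).trans (hG ⟨0, hK⟩ 0 hC0)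
  have hDn : 0 ≤ D := hrn.trans hrD
  have hKp : 1 ≤ (K : ℝ) ^ (2 / 3 : ℝ) := Real.one_le_rpow hK1 (by norm_num)
  set ρ := 1 - 1 / (K : ℝ) with hρ
  have hρ0 : 0 ≤ ρ := one_sub_inv_nonneg K
  have hρ1 : ρ ≤ 1 := by
    have : (0 : ℝ) ≤ 1 / K := by positivity
    linarith
  set p : ℕ → Vec n := fun k => (1 / (K : ℝ)) • ∑ i, grad (f i) (blockPoint v k) with hp
  have havg : ∀ {z : Fin K → Vec n} {c : ℝ}, (∀ i, ‖z i‖ ≤ c) →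
      ‖(1 / (K : ℝ)) • ∑ i, z i‖ ≤ c := by
    intro z c hz
    rw [norm_smul, Real.norm_of_nonneg (by positivity), one_div, inv_mul_le_iff₀ hK']
    refine (norm_sum_le _ _).trans ((Finset.sum_le_sum fun i _ => hz i).trans_eq ?_)
    simp
  have hbias := sum_norm_sub_blockGrad_le (K := K) p (G := G) (δ := L * (r / K)) (by positivity)
    (havg fun i => hG i _ hC0)
    (fun k hk => by
      have e : p (k + 1) - p k = (1 / (K : ℝ)) • ∑ i,
          (grad (f i) (blockPoint v (k + 1)) - grad (f i) (blockPoint v k)) := by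
        simp only [hp]
        rw [← smul_sub, Finset.sum_sub_distrib]
      rw [e]
      refine havg fun i => (hsmooth i _ (blockPoint_mem_box hvb _) _
        (blockPoint_mem_box hvb _)).trans (mul_le_mul_of_nonneg_left ?_ hL)
      exact (norm_blockPoint_succ_sub_le hvb ⟨k, hk⟩).trans
        (div_le_div_of_nonneg_right (hr _ (hv _)) hK'.le))
  -- Summing over the `K` functions absorbs the prefactor `1/K` into the mean gradient `p`; the `K`
  -- errors of order `1/K` add up to a constant.
  have h1 : ∑ i, (1 / Real.exp 1 * f i u - f i (blockPoint v K)) ≤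
      ∑ k : Fin K, ρ ^ (K - 1 - (k : ℕ)) *
        inner ℝ (hadamard (ones n - blockPoint v (k + 1)) (p (k + 1))) (u - v k)
        + (2 * G + L * r) * r := by
    refine (Finset.sum_le_sum fun i _ => blockPoint_regret hCbox hCconv hCdown hC0 hr (hnonneg i)
      (hf i) (hDR i) hL (hsmooth i) (hG i) hK hv hu).trans_eq ?_
    rw [Finset.sum_add_distrib, ← Finset.mul_sum, Finset.sum_comm]
    congr 1
    · rw [Finset.mul_sum]
      refine Finset.sum_congr rfl fun k _ => ?_
      simp only [hp, inner_hadamard]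
      rw [real_inner_smul_left, sum_inner, Finset.mul_sum, Finset.mul_sum, Finset.mul_sum]
      refine Finset.sum_congr rfl fun i _ => ?_
      ring
    · simp
      field_simp
  -- The weights and the coordinates of `1 - x` lie in `[0, 1]`, so passing from `p` to its running
  -- average costs at most `D` times the tracking error.
  have h2 : ∑ k : Fin K, ρ ^ (K - 1 - (k : ℕ)) *
        inner ℝ (hadamard (ones n - blockPoint v (k + 1)) (p (k + 1))) (u - v k) ≤
      ∑ k : Fin K, ρ ^ (K - 1 - (k : ℕ)) *
          inner ℝ (hadamard (ones n - blockPoint v (k + 1))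
            (blockGrad (fun j : Fin K => p (j + 1)) (k + 1))) (u - v k)
        + D * ∑ k : Fin K, ‖p (k + 1) - blockGrad (fun j : Fin K => p (j + 1)) (k + 1)‖ := by
    rw [Finset.mul_sum, ← Finset.sum_add_distrib]
    refine Finset.sum_le_sum fun k _ => ?_
    set g := blockGrad (fun j : Fin K => p (j + 1)) (k + 1)
    have e : inner ℝ (hadamard (ones n - blockPoint v (k + 1)) (p (k + 1))) (u - v k) =
        inner ℝ (hadamard (ones n - blockPoint v (k + 1)) g) (u - v k) +
        inner ℝ (hadamard (ones n - blockPoint v (k + 1)) (p (k + 1) - g)) (u - v k) := by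
      simp only [inner_hadamard, inner_sub_left]
      ring
    rw [e, mul_add]
    refine add_le_add le_rfl ?_
    have hb : ‖hadamard (ones n - blockPoint v (k + 1)) (p (k + 1) - g)‖ ≤
        1 * ‖p (k + 1) - g‖ := norm_hadamard_le zero_le_one fun i => by
      have := blockPoint_mem_box hvb (k + 1) i
      simp only [PiLp.sub_apply, ones_apply]
      rw [abs_le]
      constructor <;> linarith [this.1, this.2]
    rw [one_mul] at hb
    have hi := (real_inner_le_norm (hadamard (ones n - blockPoint v (k + 1)) (p (k + 1) - g))
      (u - v k)).trans (mul_le_mul hb (hD u hu _ (hv k)) (norm_nonneg _) (norm_nonneg _))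
    have hw0 : 0 ≤ ρ ^ (K - 1 - (k : ℕ)) := pow_nonneg hρ0 _
    have hw1 : ρ ^ (K - 1 - (k : ℕ)) ≤ 1 := pow_le_one₀ hρ0 hρ1
    calc _ ≤ ρ ^ (K - 1 - (k : ℕ)) * (‖p (k + 1) - g‖ * D) := mul_le_mul_of_nonneg_left hi hw0
      _ ≤ ‖p (k + 1) - g‖ * D := mul_le_of_le_one_left (by positivity) hw1
      _ = _ := mul_comm _ _
  have h3 : (2 * G + L * r) * r ≤ (2 * G + L * r) * D * (K : ℝ) ^ (2 / 3 : ℝ) := by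
    calc (2 * G + L * r) * r ≤ (2 * G + L * r) * D := by gcongr
      _ ≤ _ := le_mul_of_one_le_right (by positivity) hKp
  have h4 := mul_le_mul_of_nonneg_left hbias hDn
  have e5 : (K : ℝ) * (L * (r / K)) = L * r := by
    field_simp
  rw [e5] at h4
  have h6 : 0 ≤ D * (K : ℝ) ^ (2 / 3 : ℝ) * (2 * G) := by positivity
  linarith

end Block

/-! ### Measurability of the run. -/

section Measurability

variable {n K : ℕ}

theorem measurable_apply_of_countable {Ω ι β : Type*} [MeasurableSpace Ω] [MeasurableSpace ι]
    [Countable ι] [MeasurableSingletonClass ι] [MeasurableSpace β] {N : Ω → ι} {F : ι → Ω → β}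
    (hN : Measurable N) (hF : ∀ i, Measurable (F i)) : Measurable fun ω => F (N ω) ω :=
  (measurable_from_prod_countable_right (f := fun p : ι × Ω => F p.1 p.2) hF).comp
    (hN.prodMk measurable_id)

theorem continuous_hadamard : Continuous fun p : Vec n × Vec n => hadamard p.1 p.2 := by
  unfold hadamard
  fun_prop

variable {Ω : Type*} [MeasurableSpace Ω]

theorem measurable_hadamard {a b : Ω → Vec n} (ha : Measurable a) (hb : Measurable b) :
    Measurable fun ω => hadamard (a ω) (b ω) :=
  continuous_hadamard.measurable.comp (ha.prodMk hb)

theorem measurable_blockPoint {v : Ω → Fin K → Vec n} (hv : ∀ j, Measurable fun ω => v ω j)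
    (k : ℕ) : Measurable fun ω => blockPoint (v ω) k := by
  induction k with
  | zero => exact measurable_const
  | succ k ih =>
    by_cases h : k < K
    · simp only [blockPoint, h, dite_true]
      have := measurable_hadamard (hv ⟨k, h⟩) (ih.const_sub (ones n))
      fun_prop
    · simpa only [blockPoint, h, dite_false] using ih

theorem measurable_blockGrad {e : Ω → Fin K → Vec n} (he : ∀ j, Measurable fun ω => e ω j)
    (k : ℕ) : Measurable fun ω => blockGrad (e ω) k := by
  induction k with
  | zero => exact measurable_const
  | succ k ih =>
    by_cases h : k < K
    · simp only [blockGrad, h, dite_true]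
      have := he ⟨k, h⟩
      fun_prop
    · simpa only [blockGrad, h, dite_false] using ih

/-- Only the noise and permutations of earlier blocks are assumed measurable, and the σ-algebra on
`Ω` is arbitrary. The lemma can thus be applied to the σ-algebra generated by the past, in
`IndependentRandomness.indepFun_direction`. -/
theorem measurable_history {S Ξ : Type*} [MeasurableSpace S] [MeasurableSpace Ξ]
    {O : Fin K → LinearOracle S n}
    (hO : ∀ k q, Measurable (fun p : S × (Fin q → Vec n) => O k p.1 q p.2))
    {ζ : Ω → S} {ξ : ℕ → Ω → Ξ} {perm : ℕ → Ω → Equiv.Perm (Fin K)} {sg : ℕ → Vec n → Ξ → Vec n}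
    (hζ : Measurable ζ) (q : ℕ)
    (hsg : ∀ t < q * K, Measurable (fun p : Vec n × Ξ => sg t p.1 p.2))
    (hξ : ∀ t < q * K, Measurable (ξ t)) (hperm : ∀ p < q, Measurable (perm p)) (k : Fin K) :
    Measurable fun ω =>
      history O (ζ ω) (fun t x => sg t x (ξ t ω)) (fun p => perm p ω) q k := by
  induction q generalizing k with
  | zero => exact measurable_pi_iff.2 fun i => i.elim0
  | succ q ih =>
    have hle : q * K ≤ (q + 1) * K := Nat.mul_le_mul_right _ (Nat.le_succ q)
    have hh := fun j => ih (fun t ht => hsg t (ht.trans_le hle)) (fun t ht => hξ t (ht.trans_le hle))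
      (fun p hp => hperm p (by omega)) j
    have hv : ∀ j, Measurable fun ω => O j (ζ ω) q
        (history O (ζ ω) (fun t x => sg t x (ξ t ω)) (fun p => perm p ω) q j) := fun j =>
      (hO j q).comp (hζ.prodMk (hh j))
    refine measurable_pi_iff.2 fun i => ?_
    refine Fin.lastCases ?_ (fun i => ?_) i
    · simp only [history, Fin.snoc_last]
      refine measurable_hadamard ((measurable_blockPoint hv _).const_sub _)
        (measurable_blockGrad (fun j => ?_) _)
      -- The index of the queried function is random but takes finitely many values, so each value
      -- can be treated separately.
      refine measurable_apply_of_countable (N := fun ω => perm q ω j)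
        (F := fun (i : Fin K) ω => sg (q * K + i) (blockPoint (fun j => O j (ζ ω) q
          (history O (ζ ω) (fun t x => sg t x (ξ t ω)) (fun p => perm p ω) q j)) (j + 1))
            (ξ (q * K + i) ω))
        ((measurable_from_top (f := fun s : Equiv.Perm (Fin K) => s j)).comp (hperm q (by omega))) fun i => ?_
      have hi : q * K + i < (q + 1) * K := by
        rw [add_mul, one_mul]
        exact Nat.add_lt_add_left i.is_lt _
      exact (hsg _ hi).comp ((measurable_blockPoint hv (j + 1)).prodMk (hξ _ hi))
    · simp only [history, Fin.snoc_castSucc]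
      exact measurable_pi_iff.1 (hh k) i

theorem measurable_direction {S Ξ : Type*} [MeasurableSpace S] [MeasurableSpace Ξ]
    {O : Fin K → LinearOracle S n}
    (hO : ∀ k q, Measurable (fun p : S × (Fin q → Vec n) => O k p.1 q p.2))
    {ζ : Ω → S} {ξ : ℕ → Ω → Ξ} {perm : ℕ → Ω → Equiv.Perm (Fin K)} {sg : ℕ → Vec n → Ξ → Vec n}
    (hζ : Measurable ζ) (q : ℕ)
    (hsg : ∀ t < q * K, Measurable (fun p : Vec n × Ξ => sg t p.1 p.2))
    (hξ : ∀ t < q * K, Measurable (ξ t)) (hperm : ∀ p < q, Measurable (perm p)) (k : Fin K) :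
    Measurable fun ω =>
      direction O (ζ ω) (fun t x => sg t x (ξ t ω)) (fun p => perm p ω) q k :=
  (hO k q).comp (hζ.prodMk (measurable_history hO hζ q hsg hξ hperm k))

end Measurability

/-! ### Independence, freezing and uniform permutations. -/

section Independence

variable {Ω : Type*} [MeasurableSpace Ω] {P : Measure Ω} [IsProbabilityMeasure P]

/-- Both hypotheses together say that the law of the triple is a product of three laws;
reassociating that product gives the conclusion. -/
theorem indepFun_prodMk_right_of_prodMk_left {α β γ : Type*} [MeasurableSpace α]
    [MeasurableSpace β] [MeasurableSpace γ] {X : Ω → α} {Y : Ω → β} {Z : Ω → γ}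
    (hX : Measurable X) (hY : Measurable Y) (hZ : Measurable Z) (hXY : IndepFun X Y P)
    (hXYZ : IndepFun (fun ω => (X ω, Y ω)) Z P) : IndepFun X (fun ω => (Y ω, Z ω)) P := by
  have hYZ : IndepFun Y Z P := hXYZ.comp measurable_snd measurable_id
  have := Measure.isProbabilityMeasure_map (μ := P) hX.aemeasurable
  have := Measure.isProbabilityMeasure_map (μ := P) hY.aemeasurable
  have := Measure.isProbabilityMeasure_map (μ := P) hZ.aemeasurable
  rw [indepFun_iff_map_prod_eq_prod_map_map (by fun_prop) (by fun_prop)] at hXY hYZ hXYZ ⊢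
  rw [hYZ, ← Measure.prodAssoc_prod, ← hXY, ← hXYZ,
    Measure.map_map MeasurableEquiv.prodAssoc.measurable (by fun_prop)]
  rfl

/-- If `(A, B)` is independent of `(A', B')`, `A` of `B` and `A'` of `B'`, then `(A, A')` is
independent of `(B, B')`. -/
theorem indepFun_prodMk_prodMk_of_cross {α β α' β' : Type*} [MeasurableSpace α]
    [MeasurableSpace β] [MeasurableSpace α'] [MeasurableSpace β'] {A : Ω → α} {B : Ω → β}
    {A' : Ω → α'} {B' : Ω → β'} (hA : Measurable A) (hB : Measurable B) (hA' : Measurable A')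
    (hB' : Measurable B') (hAB : IndepFun A B P) (hAB' : IndepFun A' B' P)
    (h : IndepFun (fun ω => (A ω, B ω)) (fun ω => (A' ω, B' ω)) P) :
    IndepFun (fun ω => (A ω, A' ω)) (fun ω => (B ω, B' ω)) P := by
  have h1 : IndepFun B (fun ω => (A ω, (A' ω, B' ω))) P :=
    indepFun_prodMk_right_of_prodMk_left hB hA (hA'.prodMk hB') hAB.symm
      (h.comp measurable_swap measurable_id)
  have h2 : IndepFun B' (fun ω => (A' ω, A ω)) P :=
    indepFun_prodMk_right_of_prodMk_left hB' hA' hA hAB'.symm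
      (h.symm.comp measurable_swap measurable_fst)
  have h3 : IndepFun (fun ω => (A ω, A' ω)) (fun ω => (B' ω, B ω)) P := by
    refine indepFun_prodMk_right_of_prodMk_left (hA.prodMk hA') hB' hB
      (h2.symm.comp measurable_swap measurable_id) ?_
    exact h1.symm.comp (φ := fun p : α × (α' × β') => ((p.1, p.2.1), p.2.2)) (by fun_prop)
      measurable_id
  exact h3.comp measurable_id measurable_swap

/-- Freezing lemma: the expectation of a function of two independent variables is an iterated
expectation. -/
theorem integral_of_indepFun {α β : Type*} [MeasurableSpace α] [MeasurableSpace β] {Z : Ω → α}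
    {W : Ω → β} (hZ : Measurable Z) (hW : Measurable W) (h : IndepFun Z W P) {φ : α × β → ℝ}
    (hφ : Measurable φ) {c : ℝ} (hint : ∀ ω, Integrable (fun ω' => φ (Z ω, W ω')) P)
    (hc : ∀ ω, ∫ ω', ‖φ (Z ω, W ω')‖ ∂P ≤ c) :
    Integrable (fun ω => φ (Z ω, W ω)) P ∧
      ∫ ω, φ (Z ω, W ω) ∂P = ∫ ω, ∫ ω', φ (Z ω, W ω') ∂P ∂P := by
  -- By independence `W` may be driven by a second copy of `Ω`. Fubini then applies, the uniform
  -- bound `c` supplying integrability on the product.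
  have hmap : P.map (fun ω => (Z ω, W ω)) = (P.prod P).map (Prod.map Z W) := by
    rw [(indepFun_iff_map_prod_eq_prod_map_map hZ.aemeasurable hW.aemeasurable).1 h,
      Measure.map_prod_map _ _ hZ hW]
  have hm : Measurable (fun p : Ω × Ω => φ (Prod.map Z W p)) := hφ.comp (hZ.prodMap hW)
  have hI : Integrable (fun p : Ω × Ω => φ (Prod.map Z W p)) (P.prod P) := by
    rw [integrable_prod_iff hm.aestronglyMeasurable]
    refine ⟨Filter.Eventually.of_forall hint, ?_⟩
    refine Integrable.of_bound (C := c) ?_ (Filter.Eventually.of_forall fun ω => ?_)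
    · exact (hm.norm.stronglyMeasurable.integral_prod_right (ν := P)).aestronglyMeasurable
    · rw [Real.norm_of_nonneg (integral_nonneg fun _ => norm_nonneg _)]
      exact hc ω
  have hI' : Integrable φ (P.map (fun ω => (Z ω, W ω))) := by
    rw [hmap]
    exact (integrable_map_measure hφ.aestronglyMeasurable (hZ.prodMap hW).aemeasurable).2 hI
  refine ⟨(integrable_map_measure hφ.aestronglyMeasurable (hZ.prodMk hW).aemeasurable).1 hI', ?_⟩
  rw [← integral_map (hZ.prodMk hW).aemeasurable hφ.aestronglyMeasurable, hmap,
    integral_map (hZ.prodMap hW).aemeasurable hφ.aestronglyMeasurable, integral_prod _ hI]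
  rfl

/-- Left multiplication by a transposition maps one fibre of `s ↦ s j` bijectively onto another, so
the `K` fibres have equal size. -/
theorem card_perm_apply_eq {K : ℕ} (i j : Fin K) :
    K * (Finset.univ.filter fun s : Equiv.Perm (Fin K) => s j = i).card = K.factorial := by
  have h : ∀ i' : Fin K, (Finset.univ.filter fun s : Equiv.Perm (Fin K) => s j = i').card =
      (Finset.univ.filter fun s : Equiv.Perm (Fin K) => s j = i).card := fun i' => by
    refine Finset.card_equiv (Equiv.mulLeft (Equiv.swap i' i)) fun s => ?_
    simp only [Finset.mem_filter, Finset.mem_univ, true_and, Equiv.coe_mulLeft,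
      Equiv.Perm.mul_apply]
    rw [Equiv.swap_apply_eq_iff, Equiv.swap_apply_right]
  have h2 := Finset.card_eq_sum_card_fiberwise (s := (Finset.univ : Finset (Equiv.Perm (Fin K))))
    (t := (Finset.univ : Finset (Fin K))) (f := fun s => s j) (fun _ _ => Finset.mem_coe.2
      (Finset.mem_univ _))
  rw [Finset.sum_congr rfl fun i' _ => h i', Finset.sum_const, Finset.card_univ,
    Finset.card_univ, Fintype.card_perm, Fintype.card_fin, smul_eq_mul] at h2
  exact h2.symm

theorem measureReal_perm_apply_eq {K : ℕ} {π : Ω → Equiv.Perm (Fin K)} (hπ : Measurable π)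
    (hunif : ∀ s : Equiv.Perm (Fin K), P {ω | π ω = s} = ((K.factorial : ℕ) : ENNReal)⁻¹)
    (i j : Fin K) : P.real {ω | π ω j = i} = 1 / K := by
  have hK : (0 : ℝ) < K := by exact_mod_cast i.pos
  have hset : {ω | π ω j = i} =
      ⋃ s ∈ Finset.univ.filter fun s : Equiv.Perm (Fin K) => s j = i, {ω | π ω = s} := by
    ext ω
    simp
  rw [hset, measureReal_biUnion_finset]
  · have : ∀ s, P.real {ω | π ω = s} = (K.factorial : ℝ)⁻¹ := fun s => by
      simp [Measure.real, hunif s]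
    rw [Finset.sum_congr rfl fun s _ => this s, Finset.sum_const, nsmul_eq_mul]
    have h := card_perm_apply_eq i j
    have h' : (K : ℝ) * ((Finset.univ.filter fun s : Equiv.Perm (Fin K) => s j = i).card : ℝ) =
        K.factorial := by exact_mod_cast h
    have hf : (0 : ℝ) < K.factorial := by exact_mod_cast K.factorial_pos
    rw [← h'] at hf ⊢
    field_simp
    exact div_self (by rintro h0; simp [h0] at hf)
  · intro s _ s' _ hss
    refine Set.disjoint_left.2 fun ω h1 h2 => hss ?_
    exact h1.symm.trans h2
  · intro s _
    exact hπ (MeasurableSpace.measurableSet_top (s := {s}))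

end Independence

/-! ### Unbiasedness of the gradient estimates. -/

section Estimates

variable {n K : ℕ} {Ω S Ξ : Type*} [MeasurableSpace Ω] [MeasurableSpace S] [MeasurableSpace Ξ]
  {P : Measure Ω} [IsProbabilityMeasure P]

theorem measurable_comp_of_continuousOn {β : Type*} [TopologicalSpace β] [MeasurableSpace β]
    [BorelSpace β] {s : Set (Vec n)} {g : Vec n → β} (hg : ContinuousOn g s) {X : Ω → Vec n}
    (hX : Measurable X) (hXs : ∀ ω, X ω ∈ s) : Measurable fun ω => g (X ω) :=
  (continuousOn_iff_continuous_domRestrict.1 hg).measurable.comp (hX.subtype_mk (h := hXs))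

theorem integrable_comp_of_continuousOn_box {g : Vec n → ℝ} (hg : ContinuousOn g (box n))
    {X : Ω → Vec n} (hX : Measurable X) (hXs : ∀ ω, X ω ∈ box n) :
    Integrable (fun ω => g (X ω)) P := by
  obtain ⟨c, hc⟩ := isCompact_box.exists_bound_of_continuousOn hg
  exact Integrable.of_bound (measurable_comp_of_continuousOn hg hX hXs).aestronglyMeasurable c
    (Filter.Eventually.of_forall fun ω => hc _ (hXs ω))

theorem integrable_inner_of_bound {Y H : Ω → Vec n} {a b : ℝ} (hY : Measurable Y)
    (hH : Measurable H) (ha : ∀ ω, ‖Y ω‖ ≤ a) (hb : ∀ ω, ‖H ω‖ ≤ b) :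
    Integrable (fun ω => inner ℝ (Y ω) (H ω)) P := by
  refine Integrable.of_bound (hY.inner hH).aestronglyMeasurable (a * b)
    (Filter.Eventually.of_forall fun ω => (norm_inner_le_norm _ _).trans ?_)
  exact mul_le_mul (ha ω) (hb ω) (norm_nonneg _) ((norm_nonneg _).trans (ha ω))

/-- A bound that is uniform where `grad f` is bounded, as the freezing lemma requires; it follows
from `t ≤ 1 + t²`. -/
theorem IsStochasticGradient.integral_norm_le {f : Vec n → ℝ} {σ : ℝ} {sg : Vec n → Ξ → Vec n}
    {ξ : Ω → Ξ} (h : IsStochasticGradient P f σ sg ξ) {x : Vec n} (hx : x ∈ box n) :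
    ∫ ω, ‖sg x (ξ ω)‖ ∂P ≤ ‖grad f x‖ + (1 + σ ^ 2) := by
  have hint := (h.memLp x hx).integrable one_le_two
  have hsq : Integrable (fun ω => ‖grad f x - sg x (ξ ω)‖ ^ 2) P :=
    ((memLp_const (grad f x)).sub (h.memLp x hx)).norm.integrable_sq
  calc ∫ ω, ‖sg x (ξ ω)‖ ∂P
      ≤ ∫ ω, ((‖grad f x‖ + 1) + ‖grad f x - sg x (ξ ω)‖ ^ 2) ∂P := by
        refine integral_mono hint.norm ((integrable_const _).add hsq) fun ω => ?_
        have h1 : ‖sg x (ξ ω)‖ ≤ ‖grad f x‖ + ‖grad f x - sg x (ξ ω)‖ := by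
          simpa using norm_sub_le (grad f x) (grad f x - sg x (ξ ω))
        simp only
        nlinarith [sq_nonneg (‖grad f x - sg x (ξ ω)‖ - 1), norm_nonneg (grad f x - sg x (ξ ω))]
    _ = (‖grad f x‖ + 1) + ∫ ω, ‖grad f x - sg x (ξ ω)‖ ^ 2 ∂P := by
        rw [integral_add (integrable_const _) hsq]
        simp
    _ ≤ _ := by linarith [h.variance_le x hx]

/-- The contribution of the event that `f` is queried in position `j` to the estimate at a point
that is independent of the noise and of the permutation. -/
theorem integral_indicator_mul_inner {f : Vec n → ℝ} {σ G c : ℝ} {sg : Vec n → Ξ → Vec n}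
    {ξ : Ω → Ξ} (hsg : IsStochasticGradient P f σ sg ξ) {π : Ω → Equiv.Perm (Fin K)}
    (hξ : Measurable ξ) (hπ : Measurable π)
    (hunif : ∀ s : Equiv.Perm (Fin K), P {ω | π ω = s} = ((K.factorial : ℕ) : ENNReal)⁻¹)
    (hξπ : IndepFun ξ π P) {X H : Ω → Vec n} (hX : Measurable X) (hH : Measurable H)
    (hind : IndepFun (fun ω => (X ω, H ω)) (fun ω => (ξ ω, π ω)) P)
    (hXbox : ∀ ω, X ω ∈ box n) (hG : ∀ ω, ‖grad f (X ω)‖ ≤ G) (hHc : ∀ ω, ‖H ω‖ ≤ c)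
    (i j : Fin K) :
    Integrable (fun ω => (if π ω j = i then 1 else 0) * inner ℝ (sg (X ω) (ξ ω)) (H ω)) P ∧
      ∫ ω, (if π ω j = i then 1 else 0) * inner ℝ (sg (X ω) (ξ ω)) (H ω) ∂P =
        ∫ ω, 1 / (K : ℝ) * inner ℝ (grad f (X ω)) (H ω) ∂P := by
  set χ : Equiv.Perm (Fin K) → ℝ := fun s => if s j = i then 1 else 0 with hχ
  have hχm : Measurable χ := measurable_from_top
  have hχ1 : ∀ s, ‖χ s‖ ≤ 1 := fun s => by
    simp only [hχ]
    split_ifs <;> simp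
  have hχint : ∫ ω, χ (π ω) ∂P = 1 / K := by
    rw [← measureReal_perm_apply_eq hπ hunif i j]
    have hset : MeasurableSet {ω | π ω j = i} :=
      hπ (MeasurableSpace.measurableSet_top (s := {s : Equiv.Perm (Fin K) | s j = i}))
    rw [← integral_indicator_one hset]
    refine integral_congr_ae (Filter.Eventually.of_forall fun ω => ?_)
    simp [hχ, Set.indicator_apply]
  have hin : ∀ ω, Integrable (fun ω' => inner ℝ (sg (X ω) (ξ ω')) (H ω)) P := fun ω =>
    (((hsg.memLp _ (hXbox ω)).integrable one_le_two).inner_const _)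
  have hχi : Integrable (fun ω => χ (π ω)) P :=
    Integrable.of_bound (hχm.comp hπ).aestronglyMeasurable 1
      (Filter.Eventually.of_forall fun ω => hχ1 _)
  have hsgx : ∀ x, Measurable (sg x) := fun x => hsg.measurable.comp measurable_prodMk_left
  have hindx : ∀ ω, IndepFun (fun ω' => χ (π ω')) (fun ω' => inner ℝ (sg (X ω) (ξ ω')) (H ω)) P :=
    fun ω => hξπ.symm.comp (ψ := fun z => inner ℝ (sg (X ω) z) (H ω)) hχm
      ((hsgx _).inner measurable_const)
  have hmeas : Measurable (fun p : (Vec n × Vec n) × (Ξ × Equiv.Perm (Fin K)) =>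
      χ p.2.2 * inner ℝ (sg p.1.1 p.2.1) p.1.2) := by
    refine (hχm.comp (measurable_snd.comp measurable_snd)).mul (Measurable.inner ?_ ?_)
    · exact hsg.measurable.comp
        ((measurable_fst.comp measurable_fst).prodMk (measurable_fst.comp measurable_snd))
    · exact measurable_snd.comp measurable_fst
  have key := integral_of_indepFun (hX.prodMk hH) (hξ.prodMk hπ) hind hmeas
    (c := (G + (1 + σ ^ 2)) * c)
    (fun ω => (hindx ω).integrable_mul hχi (hin ω))
    (fun ω => by
      have hI := ((hsg.memLp _ (hXbox ω)).integrable one_le_two)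
      calc ∫ ω', ‖χ (π ω') * inner ℝ (sg (X ω) (ξ ω')) (H ω)‖ ∂P
          ≤ ∫ ω', ‖sg (X ω) (ξ ω')‖ * ‖H ω‖ ∂P := by
            refine integral_mono ((hindx ω).integrable_mul hχi (hin ω)).norm
              (hI.norm.mul_const _) fun ω' => ?_
            simp only [norm_mul]
            calc _ ≤ 1 * (‖sg (X ω) (ξ ω')‖ * ‖H ω‖) :=
                  mul_le_mul (hχ1 _) (norm_inner_le_norm _ _) (norm_nonneg _) zero_le_one
              _ = _ := one_mul _
        _ = (∫ ω', ‖sg (X ω) (ξ ω')‖ ∂P) * ‖H ω‖ := integral_mul_const _ _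
        _ ≤ (G + (1 + σ ^ 2)) * c := by
            have h1 := (hsg.integral_norm_le (hXbox ω)).trans (add_le_add_left (hG ω) _)
            exact mul_le_mul h1 (hHc ω) (norm_nonneg _)
              ((integral_nonneg fun _ => norm_nonneg _).trans h1))
  refine ⟨key.1, key.2.trans (integral_congr_ae (Filter.Eventually.of_forall fun ω => ?_))⟩
  have h1 := (hindx ω).integral_mul_eq_mul_integral hχi.aestronglyMeasurable
    (hin ω).aestronglyMeasurable
  simp only [Pi.mul_apply] at h1
  simp only
  rw [h1, hχint]
  congr 1
  simp only [real_inner_comm (H ω)]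
  rw [integral_inner ((hsg.memLp _ (hXbox ω)).integrable one_le_two), hsg.unbiased _ (hXbox ω)]

/-- The step sizes are deterministic, so the running average is linear in the estimates and equality
of expectations passes through it. The same `H` is paired with every position. -/
theorem integral_inner_blockGrad {e e' : Ω → Fin K → Vec n} {H : Ω → Vec n}
    (he : ∀ j, Integrable (fun ω => inner ℝ (e ω j) (H ω)) P)
    (he' : ∀ j, Integrable (fun ω => inner ℝ (e' ω j) (H ω)) P)
    (h : ∀ j, ∫ ω, inner ℝ (e ω j) (H ω) ∂P = ∫ ω, inner ℝ (e' ω j) (H ω) ∂P) (k : ℕ) :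
    Integrable (fun ω => inner ℝ (blockGrad (e ω) k) (H ω)) P ∧
      Integrable (fun ω => inner ℝ (blockGrad (e' ω) k) (H ω)) P ∧
      ∫ ω, inner ℝ (blockGrad (e ω) k) (H ω) ∂P = ∫ ω, inner ℝ (blockGrad (e' ω) k) (H ω) ∂P := by
  induction k with
  | zero => simp [blockGrad]
  | succ k ih =>
    by_cases hk : k < K
    · simp only [blockGrad, hk, dite_true, inner_add_left, real_inner_smul_left]
      refine ⟨(ih.1.const_mul _).add ((he _).const_mul _),
        (ih.2.1.const_mul _).add ((he' _).const_mul _), ?_⟩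
      rw [integral_add (ih.1.const_mul _) ((he _).const_mul _),
        integral_add (ih.2.1.const_mul _) ((he' _).const_mul _)]
      simp only [integral_const_mul]
      rw [ih.2.2, h]
    · simpa only [blockGrad, hk, dite_false] using ih

/-- The actions in block `q` depend only on the seed and on the randomness of the earlier blocks. -/
theorem IndependentRandomness.indepFun_direction {Q : ℕ} {ζ : Ω → S} {ξ : ℕ → Ω → Ξ}
    {perm : ℕ → Ω → Equiv.Perm (Fin K)} (hrand : IndependentRandomness P Q K ζ ξ perm)
    {O : Fin K → LinearOracle S n}
    (hO : ∀ k q, Measurable (fun p : S × (Fin q → Vec n) => O k p.1 q p.2))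
    {sg : ℕ → Vec n → Ξ → Vec n}
    (hsg : ∀ t < Q * K, Measurable (fun p : Vec n × Ξ => sg t p.1 p.2))
    {q : ℕ} (hq : q < Q) (i : Fin K) (hi : q * K + i < Q * K) :
    IndepFun (fun ω k => direction O (ζ ω) (fun t x => sg t x (ξ t ω)) (fun p => perm p ω) q k)
      (fun ω => (ξ (q * K + i) ω, perm q ω)) P := by
  have hqK : q * K ≤ Q * K := Nat.mul_le_mul_right _ hq.le
  let s : Finset (Fin (Q * K)) := Finset.univ.filter fun t => (t : ℕ) < q * K
  let s' : Finset (Fin Q) := Finset.univ.filter fun p => (p : ℕ) < q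
  let t₀ : Fin (Q * K) := ⟨q * K + i, hi⟩
  let q₀ : Fin Q := ⟨q, hq⟩
  -- `A` and `A'` collect the noise and the permutations of the blocks before `q`. Together with the
  -- seed they form the past, to be separated from the current pair `(ξ t₀, perm q₀)`.
  let A : Ω → (s → Ξ) := fun ω t => ξ (t : Fin (Q * K)) ω
  let A' : Ω → (s' → Equiv.Perm (Fin K)) := fun ω p => perm (p : Fin Q) ω
  have hξm : ∀ t : Fin (Q * K), Measurable (ξ t) := fun t => hrand.measurable_noise t t.is_lt
  have hπm : ∀ p : Fin Q, Measurable (perm p) := fun p => hrand.measurable_perm p p.is_lt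
  have hA : Measurable A := measurable_pi_iff.2 fun t => hξm t
  have hA' : Measurable A' := measurable_pi_iff.2 fun p => hπm p
  have hAB : IndepFun A (ξ t₀) P :=
    (hrand.noise_indep.indepFun_finset s {t₀} (by simp [s, t₀]) hξm).comp
      (φ := fun x : s → Ξ => x)
      (ψ := fun x : ({t₀} : Finset (Fin (Q * K))) → Ξ => x ⟨t₀, by simp⟩)
      measurable_id (measurable_pi_apply _)
  have hAB' : IndepFun A' (perm q₀) P :=
    (hrand.perm_indep.indepFun_finset s' {q₀} (by simp [s', q₀]) hπm).comp
      (φ := fun x : s' → Equiv.Perm (Fin K) => x)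
      (ψ := fun x : ({q₀} : Finset (Fin (Q))) → Equiv.Perm (Fin K) => x ⟨q₀, by simp⟩)
      measurable_id (measurable_pi_apply _)
  have hcross : IndepFun (fun ω => (A ω, ξ t₀ ω)) (fun ω => (A' ω, perm q₀ ω)) P :=
    hrand.noise_perm_indep.comp (φ := fun x => ((fun t : s => x t), x t₀))
      (ψ := fun x => ((fun p : s' => x p), x q₀)) (by fun_prop) (by fun_prop)
  have h1 := indepFun_prodMk_prodMk_of_cross hA (hξm t₀) hA' (hπm q₀) hAB hAB' hcross
  have h2 : IndepFun (fun ω => ((ξ t₀ ω, perm q₀ ω), (A ω, A' ω))) ζ P :=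
    hrand.seed_indep.symm.comp (φ := fun x => ((x.1 t₀, x.2 q₀),
      ((fun t : s => x.1 t), (fun p : s' => x.2 p)))) (by fun_prop) measurable_id
  have h3 := indepFun_prodMk_right_of_prodMk_left ((hξm t₀).prodMk (hπm q₀)) (hA.prodMk hA')
    hrand.measurable_seed h1.symm h2
  have hdir : Measurable[MeasurableSpace.comap (fun ω => ((A ω, A' ω), ζ ω)) inferInstance]
      (fun ω k => direction O (ζ ω) (fun t x => sg t x (ξ t ω)) (fun p => perm p ω) q k) := by
    -- `Ω` is given the σ-algebra of the past, so that `measurable_direction` yields dependence on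
    -- the past alone.
    let m : MeasurableSpace Ω := MeasurableSpace.comap (fun ω => ((A ω, A' ω), ζ ω)) inferInstance
    have hm : Measurable[m] (fun ω => ((A ω, A' ω), ζ ω)) := comap_measurable _
    refine measurable_pi_iff.2 fun k => measurable_direction hO (measurable_snd.comp hm) q
      (fun t ht => hsg t (ht.trans_le hqK)) (fun t ht => ?_) (fun p hp => ?_) k
    · exact (measurable_pi_apply (⟨⟨t, ht.trans_le hqK⟩, by simp [s, ht]⟩ : s)).comp
        (measurable_fst.comp (measurable_fst.comp hm))
    · exact (measurable_pi_apply (⟨⟨p, hp.trans hq⟩, by simp [s', hp]⟩ : s')).comp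
        (measurable_snd.comp (measurable_fst.comp hm))
  exact indep_of_indep_of_le_left h3.symm hdir.comap_le

end Estimates

/-! ### Radius, diameter and the sign of the smoothness constant. -/

section Geometry

variable {n : ℕ} {C : Set (Vec n)}

theorem isBounded_of_subset_box (hC : C ⊆ box n) : Bornology.IsBounded C :=
  isCompact_box.isBounded.subset hC

theorem norm_le_radius (hC : C ⊆ box n) {x : Vec n} (hx : x ∈ C) : ‖x‖ ≤ radius C := by
  obtain ⟨c, hc⟩ := (isBounded_of_subset_box hC).exists_norm_le
  exact le_csSup ⟨c, by rintro _ ⟨y, hy, rfl⟩; exact hc y hy⟩ ⟨x, hx, rfl⟩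

theorem radius_nonneg (hC : C ⊆ box n) (hC0 : (0 : Vec n) ∈ C) : 0 ≤ radius C :=
  (norm_nonneg _).trans (norm_le_radius hC hC0)

theorem norm_sub_le_diam (hC : C ⊆ box n) {x y : Vec n} (hx : x ∈ C) (hy : y ∈ C) :
    ‖x - y‖ ≤ Metric.diam C := by
  rw [← dist_eq_norm]
  exact Metric.dist_le_diam_of_mem (isBounded_of_subset_box hC) hx hy

theorem radius_le_diam (hC : C ⊆ box n) (hC0 : (0 : Vec n) ∈ C) : radius C ≤ Metric.diam C := by
  refine csSup_le ⟨_, 0, hC0, rfl⟩ ?_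
  rintro _ ⟨x, hx, rfl⟩
  simpa using norm_sub_le_diam hC hx hC0

theorem IsSmooth.max_zero {f : Vec n → ℝ} {L : ℝ} (h : IsSmooth L f) : IsSmooth (max L 0) f :=
  fun x hx y hy => (h x hx y hy).trans
    (mul_le_mul_of_nonneg_right (le_max_left _ _) (norm_nonneg _))

/-- A negative smoothness constant forces every point of `C` to have norm `0`. The radius then
vanishes, and the constant may be assumed nonnegative without changing the bound. -/
theorem IsSmooth.max_zero_mul_radius {f : Vec n → ℝ} {L : ℝ} (h : IsSmooth L f) (hC : C ⊆ box n)
    (hC0 : (0 : Vec n) ∈ C) : max L 0 * radius C = L * radius C := by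
  rcases le_or_gt 0 L with hL | hL
  · rw [max_eq_left hL]
  · have h0 : radius C = 0 := by
      refine le_antisymm (csSup_le ⟨_, 0, hC0, rfl⟩ ?_) (radius_nonneg hC hC0)
      rintro _ ⟨x, hx, rfl⟩
      have h1 := (norm_nonneg _).trans (h x (hC hx) 0 zero_mem_box)
      rw [sub_zero] at h1
      simp only
      nlinarith [norm_nonneg x]
    rw [h0, mul_zero, mul_zero]

end Geometry

theorem sum_range_mul_eq {M : Type*} [AddCommMonoid M] (F : ℕ → M) (Q K : ℕ) :
    ∑ t ∈ Finset.range (Q * K), F t =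
      ∑ q ∈ Finset.range Q, ∑ i : Fin K, F (q * K + i) := by
  induction Q with
  | zero => simp
  | succ Q ih =>
    rw [add_mul, one_mul, Finset.sum_range_add, Finset.sum_range_succ, ih,
      Finset.sum_range fun i => F (Q * K + i)]

theorem lt_mul_of_lt {Q K q : ℕ} (hq : q < Q) (i : Fin K) : q * K + i < Q * K :=
  calc q * K + i < q * K + K := Nat.add_lt_add_left i.is_lt _
    _ = (q + 1) * K := by ring
    _ ≤ Q * K := Nat.mul_le_mul_right _ hq

/-! ### The run expressed through the one-block recursions. -/

section Unfolding

variable {n K : ℕ} {S : Type*}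

theorem play_eq (O : Fin K → LinearOracle S n) (s : S) (sgrad : ℕ → Vec n → Vec n)
    (perm : ℕ → Equiv.Perm (Fin K)) (q : ℕ) (i : Fin K) :
    play O s sgrad perm (q * K + i) = blockPoint (direction O s sgrad perm q) K := by
  have h : (q * K + (i : ℕ)) / K = q := by
    rw [mul_comm, Nat.mul_add_div i.pos, Nat.div_eq_of_lt i.is_lt, add_zero]
  rw [play, point, h]

theorem feedback_eq (O : Fin K → LinearOracle S n) (s : S) (sgrad : ℕ → Vec n → Vec n)
    (perm : ℕ → Equiv.Perm (Fin K)) (q : ℕ) (k : Fin K) :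
    feedback O s sgrad perm q k =
      hadamard (ones n - blockPoint (direction O s sgrad perm q) (k + 1))
        (blockGrad (fun j => sgrad (q * K + perm q j)
          (blockPoint (direction O s sgrad perm q) (j + 1))) (k + 1)) := by
  simp only [feedback, history, Fin.snoc_last]
  rfl

end Unfolding

/-! ### From one block to the whole run, in expectation. -/

section Run

variable {n K Q : ℕ} {Ω S Ξ : Type*} [MeasurableSpace Ω] [MeasurableSpace S] [MeasurableSpace Ξ]
  {P : Measure Ω} [IsProbabilityMeasure P]

/-- In expectation, the linear rewards are those of the averages of the exact mean gradients. -/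
theorem integral_feedback {ζ : Ω → S} {ξ : ℕ → Ω → Ξ}
    {perm : ℕ → Ω → Equiv.Perm (Fin K)} (hrand : IndependentRandomness P Q K ζ ξ perm)
    {C : Set (Vec n)} (hCbox : C ⊆ box n) (hCconv : Convex ℝ C) (hCdown : IsDownClosed C)
    (hC0 : (0 : Vec n) ∈ C) {f : ℕ → Vec n → ℝ} {L G σ : ℝ}
    (hfsmooth : ∀ t < Q * K, IsSmooth L (f t))
    (hfG : ∀ t < Q * K, ∀ x ∈ C, ‖grad (f t) x‖ ≤ G)
    {sg : ℕ → Vec n → Ξ → Vec n}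
    (hsg : ∀ t < Q * K, IsStochasticGradient P (f t) σ (sg t) (ξ t))
    {O : Fin K → LinearOracle S n}
    (hOmeas : ∀ k q, Measurable (fun p : S × (Fin q → Vec n) => O k p.1 q p.2))
    (hOmem : ∀ k s q h, O k s q h ∈ C) {v : Ω → Fin K → Vec n} {q : ℕ} (hq : q < Q)
    (hv : v = fun ω => direction O (ζ ω) (fun t x => sg t x (ξ t ω)) (fun p => perm p ω) q)
    (k : Fin K) {u : Vec n} (hu : u ∈ C) :
    Integrable (fun ω => inner ℝ
        (feedback O (ζ ω) (fun t x => sg t x (ξ t ω)) (fun p => perm p ω) q k) (u - v ω k)) P ∧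
      Integrable (fun ω => inner ℝ (hadamard (ones n - blockPoint (v ω) (k + 1))
        (blockGrad (fun j : Fin K => (1 / (K : ℝ)) •
          ∑ i : Fin K, grad (f (q * K + i)) (blockPoint (v ω) (j + 1))) (k + 1))) (u - v ω k)) P ∧
      ∫ ω, inner ℝ (feedback O (ζ ω) (fun t x => sg t x (ξ t ω)) (fun p => perm p ω) q k)
          (u - v ω k) ∂P =
        ∫ ω, inner ℝ (hadamard (ones n - blockPoint (v ω) (k + 1))
          (blockGrad (fun j : Fin K => (1 / (K : ℝ)) •
            ∑ i : Fin K, grad (f (q * K + i)) (blockPoint (v ω) (j + 1))) (k + 1)))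
              (u - v ω k) ∂P := by
  have hvC : ∀ ω j, v ω j ∈ C := fun ω j => by
    rw [hv]
    exact hOmem _ _ _ _
  have hvb : ∀ ω j, v ω j ∈ box n := fun ω j => hCbox (hvC ω j)
  have hqK : q * K ≤ Q * K := Nat.mul_le_mul_right _ hq.le
  have hsgm : ∀ t < Q * K, Measurable (fun p : Vec n × Ξ => sg t p.1 p.2) :=
    fun t ht => (hsg t ht).measurable
  have hvm : ∀ j, Measurable fun ω => v ω j := fun j => by
    rw [hv]
    exact measurable_direction hOmeas hrand.measurable_seed q
      (fun t ht => hsgm t (ht.trans_le hqK))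
      (fun t ht => hrand.measurable_noise t (ht.trans_le hqK))
      (fun p hp => hrand.measurable_perm p (hp.trans hq)) j
  have hxm : ∀ j, Measurable fun ω => blockPoint (v ω) j := measurable_blockPoint hvm
  have hxC : ∀ ω (j : Fin K), blockPoint (v ω) (j + 1) ∈ C := fun ω j =>
    blockPoint_mem hCbox hCconv hCdown hC0 (hvC ω) j.is_lt
  -- Moving the factor `1 - x` to the other side of the inner product collects everything besides
  -- the averaged gradient in `H`, a function of the directions of the block only.
  set H : Ω → Vec n := fun ω => hadamard (ones n - blockPoint (v ω) (k + 1)) (u - v ω k) with hH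
  have hHm : Measurable H :=
    measurable_hadamard ((hxm _).const_sub _) ((hvm k).const_sub _)
  have hHc : ∀ ω, ‖H ω‖ ≤ Metric.diam C := fun ω => by
    refine (norm_hadamard_le zero_le_one fun i => ?_).trans
      ((one_mul _).trans_le (norm_sub_le_diam hCbox hu (hvC ω k)))
    have := blockPoint_mem_box (hvb ω) (k + 1) i
    simp only [PiLp.sub_apply, ones_apply]
    rw [abs_le]
    constructor <;> linarith [this.1, this.2]
  have hgm : ∀ (i j : Fin K), Measurable fun ω => grad (f (q * K + i)) (blockPoint (v ω) (j + 1)) :=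
    fun i j => measurable_comp_of_continuousOn
      (continuousOn_grad (hfsmooth _ (lt_mul_of_lt hq i))) (hxm _) fun ω => hCbox (hxC ω j)
  have hgi : ∀ (i j : Fin K), Integrable
      (fun ω => inner ℝ (grad (f (q * K + i)) (blockPoint (v ω) (j + 1))) (H ω)) P := fun i j =>
    integrable_inner_of_bound (hgm i j) hHm
      (fun ω => hfG _ (lt_mul_of_lt hq i) _ (hxC ω j)) hHc
  have hest : ∀ i j : Fin K, _ := fun i j => by
    have hiq := lt_mul_of_lt hq i
    have hind := hrand.indepFun_direction hOmeas hsgm hq i hiq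
    have hind' : IndepFun (fun ω => (blockPoint (v ω) (j + 1), H ω))
        (fun ω => (ξ (q * K + i) ω, perm q ω)) P := by
      have hm : ∀ j, Measurable fun w : Fin K → Vec n => blockPoint w j :=
        measurable_blockPoint fun j => measurable_pi_apply j
      have hφ : Measurable fun w : Fin K → Vec n => (blockPoint w (j + 1),
          hadamard (ones n - blockPoint w (k + 1)) (u - w k)) :=
        (hm _).prodMk (measurable_hadamard ((hm _).const_sub _)
          ((measurable_pi_apply k).const_sub _))
      have := hind.comp hφ measurable_id
      rw [hH, hv]
      exact this
    have hξπ : IndepFun (ξ (q * K + i)) (perm q) P :=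
      hrand.noise_perm_indep.comp (φ := fun x : Fin (Q * K) → Ξ => x ⟨q * K + i, hiq⟩)
        (ψ := fun x : Fin Q → Equiv.Perm (Fin K) => x ⟨q, hq⟩)
        (measurable_pi_apply _) (measurable_pi_apply _)
    exact integral_indicator_mul_inner (hsg _ hiq) (hrand.measurable_noise _ hiq)
      (hrand.measurable_perm q hq) (hrand.perm_uniform q hq) hξπ (hxm _) hHm hind'
      (fun ω => hCbox (hxC ω j)) (fun ω => hfG _ hiq _ (hxC ω j)) hHc i j
  -- Splitting according to which function is queried in position `j` turns the random index into
  -- indicators of probability `1/K`.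
  have hsum : ∀ (j : Fin K) ω, inner ℝ (sg (q * K + perm q ω j) (blockPoint (v ω) (j + 1))
      (ξ (q * K + perm q ω j) ω)) (H ω) = ∑ i : Fin K, (if perm q ω j = i then 1 else 0) *
        inner ℝ (sg (q * K + i) (blockPoint (v ω) (j + 1)) (ξ (q * K + i) ω)) (H ω) := by
    intro j ω
    simp
  have hmean : ∀ (j : Fin K) ω, inner ℝ ((1 / (K : ℝ)) •
      ∑ i : Fin K, grad (f (q * K + i)) (blockPoint (v ω) (j + 1))) (H ω) =
      ∑ i : Fin K, 1 / (K : ℝ) *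
        inner ℝ (grad (f (q * K + i)) (blockPoint (v ω) (j + 1))) (H ω) := by
    intro j ω
    rw [real_inner_smul_left, sum_inner, Finset.mul_sum]
  have key := integral_inner_blockGrad (P := P)
    (e := fun ω j => sg (q * K + perm q ω j) (blockPoint (v ω) (j + 1))
      (ξ (q * K + perm q ω j) ω))
    (e' := fun ω j => (1 / (K : ℝ)) •
      ∑ i : Fin K, grad (f (q * K + i)) (blockPoint (v ω) (j + 1))) (H := H)
    (fun j => by
      simp only [hsum]
      exact integrable_finsetSum _ fun i _ => (hest i j).1)
    (fun j => by
      simp only [hmean]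
      exact integrable_finsetSum _ fun i _ => (hgi i j).const_mul _)
    (fun j => by
      simp only [hsum, hmean]
      rw [integral_finsetSum _ fun i _ => (hest i j).1,
        integral_finsetSum _ fun i _ => (hgi i j).const_mul _]
      exact Finset.sum_congr rfl fun i _ => (hest i j).2) (k + 1)
  have hfb : ∀ ω, inner ℝ
      (feedback O (ζ ω) (fun t x => sg t x (ξ t ω)) (fun p => perm p ω) q k) (u - v ω k) =
      inner ℝ (blockGrad (fun j => sg (q * K + perm q ω j) (blockPoint (v ω) (j + 1))
        (ξ (q * K + perm q ω j) ω)) (k + 1)) (H ω) := fun ω => by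
    rw [feedback_eq, inner_hadamard, hH, hv]
  simp only [hfb, inner_hadamard]
  exact key

theorem integrable_reward {ζ : Ω → S} {ξ : ℕ → Ω → Ξ}
    {perm : ℕ → Ω → Equiv.Perm (Fin K)} (hrand : IndependentRandomness P Q K ζ ξ perm)
    {C : Set (Vec n)} (hCbox : C ⊆ box n) {g : Vec n → ℝ} (hg : ContinuousOn g (box n))
    {sg : ℕ → Vec n → Ξ → Vec n}
    (hsg : ∀ t < Q * K, Measurable (fun p : Vec n × Ξ => sg t p.1 p.2))
    {O : Fin K → LinearOracle S n}
    (hOmeas : ∀ k q, Measurable (fun p : S × (Fin q → Vec n) => O k p.1 q p.2))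
    (hOmem : ∀ k s q h, O k s q h ∈ C) {q : ℕ} (hq : q < Q) :
    Integrable (fun ω => g (blockPoint
      (direction O (ζ ω) (fun t x => sg t x (ξ t ω)) (fun p => perm p ω) q) K)) P := by
  have hqK : q * K ≤ Q * K := Nat.mul_le_mul_right _ hq.le
  refine integrable_comp_of_continuousOn_box hg (measurable_blockPoint (fun j => ?_) K)
    (fun ω => blockPoint_mem_box (fun j => hCbox (hOmem _ _ _ _)) K)
  exact measurable_direction hOmeas hrand.measurable_seed q
      (fun t ht => hsg t (ht.trans_le hqK))
      (fun t ht => hrand.measurable_noise t (ht.trans_le hqK))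
      (fun p hp => hrand.measurable_perm p (hp.trans hq)) j

/-- The block bounds are integrated and summed against a fixed comparator; the supremum is taken
only in the final theorem. -/
theorem regret_le {ζ : Ω → S} {ξ : ℕ → Ω → Ξ}
    {perm : ℕ → Ω → Equiv.Perm (Fin K)} (hrand : IndependentRandomness P Q K ζ ξ perm)
    {C : Set (Vec n)} (hCbox : C ⊆ box n) (hCconv : Convex ℝ C) (hCdown : IsDownClosed C)
    (hC0 : (0 : Vec n) ∈ C) {f : ℕ → Vec n → ℝ} {L G σ : ℝ}
    (hfnonneg : ∀ t < Q * K, ∀ x ∈ box n, 0 ≤ f t x)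
    (hfdiff : ∀ t < Q * K, DifferentiableOn ℝ (f t) (box n))
    (hfDR : ∀ t < Q * K, IsDRSubmodular (f t))
    (hL : 0 ≤ L) (hfsmooth : ∀ t < Q * K, IsSmooth L (f t))
    (hfG : ∀ t < Q * K, ∀ x ∈ C, ‖grad (f t) x‖ ≤ G)
    {sg : ℕ → Vec n → Ξ → Vec n}
    (hsg : ∀ t < Q * K, IsStochasticGradient P (f t) σ (sg t) (ξ t))
    {O : Fin K → LinearOracle S n}
    (hOmeas : ∀ k q, Measurable (fun p : S × (Fin q → Vec n) => O k p.1 q p.2))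
    (hOmem : ∀ k s q h, O k s q h ∈ C) (hK : 1 ≤ K) {u : Vec n} (hu : u ∈ C) {B : ℝ} (hB : 0 ≤ B)
    (hOregret : ∀ k : Fin K,
      ∫ ω, ∑ q ∈ Finset.range Q,
        (inner ℝ (feedback O (ζ ω) (fun t x => sg t x (ξ t ω)) (fun q => perm q ω) q k)
          (u - direction O (ζ ω) (fun t x => sg t x (ξ t ω)) (fun q => perm q ω) q k) : ℝ) ∂P
        ≤ B) :
    ∑ t ∈ Finset.range (Q * K), (1 / Real.exp 1 * f t u -
        ∫ ω, f t (play O (ζ ω) (fun t x => sg t x (ξ t ω)) (fun q => perm q ω) t) ∂P) ≤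
      B * K + Q * (3 * (2 * G + L * radius C) * Metric.diam C * (K : ℝ) ^ (2 / 3 : ℝ)) := by
  set E := 3 * (2 * G + L * radius C) * Metric.diam C * (K : ℝ) ^ (2 / 3 : ℝ) with hE
  set ρ := 1 - 1 / (K : ℝ) with hρ
  have hρ0 : 0 ≤ ρ := one_sub_inv_nonneg K
  have hρ1 : ρ ≤ 1 := by
    have : (0 : ℝ) ≤ 1 / K := by positivity
    linarith
  have hfb₀ := fun (q : ℕ) (hq : q < Q) (k : Fin K) => integral_feedback hrand hCbox hCconv hCdown
    hC0 hfsmooth hfG hsg hOmeas hOmem hq rfl k hu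
  set V : ℕ → Ω → Fin K → Vec n := fun q ω =>
    direction O (ζ ω) (fun t x => sg t x (ξ t ω)) (fun p => perm p ω) q with hV
  set Φ : ℕ → Fin K → Ω → ℝ := fun q k ω => inner ℝ
    (feedback O (ζ ω) (fun t x => sg t x (ξ t ω)) (fun p => perm p ω) q k) (u - V q ω k) with hΦ
  set Ψ : ℕ → Fin K → Ω → ℝ := fun q k ω => inner ℝ
    (hadamard (ones n - blockPoint (V q ω) (k + 1)) (blockGrad (fun j : Fin K => (1 / (K : ℝ)) •
      ∑ i : Fin K, grad (f (q * K + i)) (blockPoint (V q ω) (j + 1))) (k + 1))) (u - V q ω k)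
    with hΨ
  have hfb : ∀ q < Q, ∀ k, Integrable (Φ q k) P ∧ Integrable (Ψ q k) P ∧
      ∫ ω, Φ q k ω ∂P = ∫ ω, Ψ q k ω ∂P := hfb₀
  have hblock : ∀ q < Q, ∑ i : Fin K, (1 / Real.exp 1 * f (q * K + i) u -
        ∫ ω, f (q * K + i) (blockPoint (V q ω) K) ∂P) ≤
      ∑ k : Fin K, ρ ^ (K - 1 - (k : ℕ)) * ∫ ω, Φ q k ω ∂P + E := by
    intro q hq
    have hlt := fun i : Fin K => lt_mul_of_lt hq i
    have hfi : ∀ i : Fin K, Integrable (fun ω => f (q * K + i) (blockPoint (V q ω) K)) P :=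
      fun i => integrable_reward hrand hCbox (hfdiff _ (hlt i)).continuousOn
        (fun t ht => (hsg t ht).measurable) hOmeas hOmem hq
    have hdet := fun ω => block_regret (f := fun i : Fin K => f (q * K + i)) hCbox hCconv hCdown
      hC0 (fun x hx => norm_le_radius hCbox hx) (radius_le_diam hCbox hC0)
      (fun x hx y hy => norm_sub_le_diam hCbox hx hy) (fun i => hfnonneg _ (hlt i))
      (fun i => hfdiff _ (hlt i)) (fun i => hfDR _ (hlt i)) hL (fun i => hfsmooth _ (hlt i))
      (fun i => hfG _ (hlt i)) hK (v := V q ω) (fun j => hOmem _ _ _ _) hu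
    have hI₁ : ∀ i : Fin K, Integrable (fun ω => 1 / Real.exp 1 * f (q * K + i) u -
        f (q * K + i) (blockPoint (V q ω) K)) P := fun i => (integrable_const _).sub (hfi i)
    have hI₂ : ∀ k : Fin K, Integrable (fun ω => ρ ^ (K - 1 - (k : ℕ)) * Ψ q k ω) P :=
      fun k => (hfb q hq k).2.1.const_mul _
    have hint : ∫ ω, ∑ i : Fin K, (1 / Real.exp 1 * f (q * K + i) u -
        f (q * K + i) (blockPoint (V q ω) K)) ∂P ≤
        ∫ ω, (∑ k : Fin K, ρ ^ (K - 1 - (k : ℕ)) * Ψ q k ω + E) ∂P :=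
      integral_mono (integrable_finsetSum _ fun i _ => hI₁ i)
        ((integrable_finsetSum _ fun k _ => hI₂ k).add (integrable_const _)) hdet
    rw [integral_add (integrable_finsetSum _ fun k _ => hI₂ k) (integrable_const _),
      integral_finsetSum _ fun i _ => hI₁ i, integral_finsetSum _ fun k _ => hI₂ k] at hint
    simp only [integral_const_mul, ← (hfb q hq _).2.2] at hint
    simp only [integral_const, probReal_univ, one_smul] at hint
    refine le_trans (le_of_eq (Finset.sum_congr rfl fun i _ => ?_)) hint
    rw [integral_sub (integrable_const _) (hfi i)]
    simp
  rw [sum_range_mul_eq]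
  simp only [play_eq]
  calc _ ≤ ∑ q ∈ Finset.range Q, (∑ k : Fin K, ρ ^ (K - 1 - (k : ℕ)) * ∫ ω, Φ q k ω ∂P + E) :=
        Finset.sum_le_sum fun q hq => hblock q (Finset.mem_range.1 hq)
    -- The weights depend on `k` but not on the block, so the sum over blocks is the regret of the
    -- oracle `k` at horizon `Q`.
    _ = ∑ k : Fin K, ρ ^ (K - 1 - (k : ℕ)) * (∫ ω, ∑ q ∈ Finset.range Q, Φ q k ω ∂P) + Q * E := by
        rw [Finset.sum_add_distrib, Finset.sum_comm]
        congr 1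
        · refine Finset.sum_congr rfl fun k _ => ?_
          rw [integral_finsetSum _ fun q hq => (hfb q (Finset.mem_range.1 hq) k).1,
            Finset.mul_sum]
        · simp
    _ ≤ ∑ k : Fin K, B + Q * E := by
        gcongr with k
        exact (mul_le_mul_of_nonneg_left (hOregret k) (pow_nonneg hρ0 _)).trans
          (mul_le_of_le_one_left hB (pow_le_one₀ hρ0 hρ1))
    _ = B * K + Q * E := by
        simp [mul_comm]

end Run

/-- With `a = 2G + L r`, the second entry of the maximum is at least `32 a²`, and `64 a² + 2 ≥ 3 a`
for every real `a`. -/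
theorem three_mul_le_constN (G σ L r : ℝ) :
    3 * (2 * G + L * r) ≤ 2 * (constN G σ L r + 1) := by
  have h : 8 * (σ ^ 2 + G ^ 2) + 32 * (2 * G + L * r) ^ 2 ≤ constN G σ L r :=
    (le_max_left _ _).trans (le_max_right _ _)
  nlinarith [sq_nonneg σ, sq_nonneg G, sq_nonneg (2 * G + L * r - 1)]

end MonoMFW

/-! ### The regret bound and the rate. -/

theorem theorem2 {n K Q : ℕ} (hK : 1 ≤ K) (hQ : 1 ≤ Q)
    {Ω S Ξ : Type*} [MeasurableSpace Ω] [MeasurableSpace S] [MeasurableSpace Ξ]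
    (P : Measure Ω) [IsProbabilityMeasure P]
    -- the domain
    (C : Set (Vec n)) (hCbox : C ⊆ box n) (hCconv : Convex ℝ C) (hCdown : IsDownClosed C)
    (hC0 : (0 : Vec n) ∈ C)
    -- the reward functions `f 0, …, f (T - 1)`, with `T = Q * K`
    (f : ℕ → Vec n → ℝ) (L₀ G : ℝ)
    (hfnonneg : ∀ t < Q * K, ∀ x ∈ box n, 0 ≤ f t x)
    (hfdiff : ∀ t < Q * K, DifferentiableOn ℝ (f t) (box n))
    (hfDR : ∀ t < Q * K, IsDRSubmodular (f t))
    (hfsmooth : ∀ t < Q * K, IsSmooth L₀ (f t))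
    (hfG : ∀ t < Q * K, ∀ x ∈ C, ‖grad (f t) x‖ ≤ G)
    -- the random inputs and the stochastic gradients
    (ζ : Ω → S) (ξ : ℕ → Ω → Ξ) (perm : ℕ → Ω → Equiv.Perm (Fin K))
    (hrand : IndependentRandomness P Q K ζ ξ perm)
    (sg : ℕ → Vec n → Ξ → Vec n) (σ : ℝ)
    (hsg : ∀ t < Q * K, IsStochasticGradient P (f t) σ (sg t) (ξ t))
    -- the linear oracles over `C`
    (O : Fin K → LinearOracle S n)
    (hOmeas : ∀ k q, Measurable (fun p : S × (Fin q → Vec n) => O k p.1 q p.2))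
    (hOmem : ∀ k s q h, O k s q h ∈ C)
    -- in the run of the algorithm, every oracle has expected regret at most `M₀ √m` at horizon `m`
    (M₀ : ℝ) (hM₀ : 0 ≤ M₀)
    (hOregret : ∀ k : Fin K, ∀ m ≤ Q, ∀ u ∈ C,
      ∫ ω, ∑ q ∈ Finset.range m,
        (inner ℝ (feedback O (ζ ω) (fun t x => sg t x (ξ t ω)) (fun q => perm q ω) q k)
          (u - direction O (ζ ω) (fun t x => sg t x (ξ t ω)) (fun q => perm q ω) q k) : ℝ) ∂P
        ≤ M₀ * √(m : ℝ)) :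
    -- the rewards have finite expectations, and
    (∀ t < Q * K, Integrable (fun ω =>
      f t (play O (ζ ω) (fun t x => sg t x (ξ t ω)) (fun q => perm q ω) t)) P) ∧
    -- the regret bound
    expectedRegret P (1 / Real.exp 1) C (Q * K) f
        (fun t ω => play O (ζ ω) (fun t x => sg t x (ξ t ω)) (fun q => perm q ω) t)
      ≤ 2 * Metric.diam C * (constN G σ L₀ (radius C) + 1) * Q * (K : ℝ) ^ (2 / 3 : ℝ)
        + L₀ * radius C ^ 2 / 2 * Q + M₀ * √(Q : ℝ) * K ∧
    -- the rate `O(T ^ (4/5))` for `K = T ^ (3/5)` and `Q = T ^ (2/5)`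
    ((K : ℝ) = ((Q * K : ℕ) : ℝ) ^ (3 / 5 : ℝ) → (Q : ℝ) = ((Q * K : ℕ) : ℝ) ^ (2 / 5 : ℝ) →
      expectedRegret P (1 / Real.exp 1) C (Q * K) f
          (fun t ω => play O (ζ ω) (fun t x => sg t x (ξ t ω)) (fun q => perm q ω) t)
        ≤ (2 * Metric.diam C * (constN G σ L₀ (radius C) + 1)
            + L₀ * radius C ^ 2 / 2 + M₀) * ((Q * K : ℕ) : ℝ) ^ (4 / 5 : ℝ)) := by
  have hK1 : (1 : ℝ) ≤ K := by exact_mod_cast hK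
  have hQ1 : (1 : ℝ) ≤ Q := by exact_mod_cast hQ
  have hT : 0 < Q * K := Nat.mul_pos hQ hK
  have hrn := radius_nonneg hCbox hC0
  have hDn : 0 ≤ Metric.diam C := Metric.diam_nonneg
  have hLr := (hfsmooth 0 hT).max_zero_mul_radius hCbox hC0
  have hLr0 : 0 ≤ L₀ * radius C := hLr ▸ mul_nonneg (le_max_right _ _) hrn
  have hKp : 0 ≤ (K : ℝ) ^ (2 / 3 : ℝ) := by positivity
  have hquad : 0 ≤ L₀ * radius C ^ 2 / 2 := by
    have := mul_nonneg hLr0 hrn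
    nlinarith
  have hmain : expectedRegret P (1 / Real.exp 1) C (Q * K) f
        (fun t ω => play O (ζ ω) (fun t x => sg t x (ξ t ω)) (fun q => perm q ω) t)
      ≤ 2 * Metric.diam C * (constN G σ L₀ (radius C) + 1) * Q * (K : ℝ) ^ (2 / 3 : ℝ)
        + L₀ * radius C ^ 2 / 2 * Q + M₀ * √(Q : ℝ) * K := by
    have hu : ∀ u ∈ C, _ := fun u hu => regret_le hrand hCbox hCconv hCdown hC0 hfnonneg hfdiff hfDR
      (le_max_right L₀ 0) (fun t ht => (hfsmooth t ht).max_zero) hfG hsg hOmeas hOmem hK hu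
      (mul_nonneg hM₀ (Real.sqrt_nonneg _)) (fun k => hOregret k Q le_rfl u hu)
    have herr : (Q : ℝ) * (3 * (2 * G + max L₀ 0 * radius C) * Metric.diam C *
        (K : ℝ) ^ (2 / 3 : ℝ)) ≤
        2 * Metric.diam C * (constN G σ L₀ (radius C) + 1) * Q * (K : ℝ) ^ (2 / 3 : ℝ) := by
      rw [hLr]
      have := mul_le_mul_of_nonneg_right (three_mul_le_constN G σ L₀ (radius C))
        (by positivity : 0 ≤ Metric.diam C * (K : ℝ) ^ (2 / 3 : ℝ) * Q)
      linarith
    -- The quadratic term of the bound is pure slack here; only its sign matters.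
    have hquadQ : 0 ≤ L₀ * radius C ^ 2 / 2 * Q := by positivity
    unfold expectedRegret
    set J := ∑ t ∈ Finset.range (Q * K),
      ∫ ω, f t (play O (ζ ω) (fun t x => sg t x (ξ t ω)) (fun q => perm q ω) t) ∂P with hJ
    set R := 2 * Metric.diam C * (constN G σ L₀ (radius C) + 1) * Q * (K : ℝ) ^ (2 / 3 : ℝ)
        + L₀ * radius C ^ 2 / 2 * Q + M₀ * √(Q : ℝ) * K with hR
    have hexp : 0 < Real.exp 1 := Real.exp_pos 1
    -- `C` need not be closed, so the supremum is bounded through all comparators instead of a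
    -- maximizer.
    have hsup : sSup ((fun x => ∑ t ∈ Finset.range (Q * K), f t x) '' C) ≤
        Real.exp 1 * (R + J) := by
      refine csSup_le ⟨_, 0, hC0, rfl⟩ ?_
      rintro _ ⟨u, huC, rfl⟩
      have h := hu u huC
      rw [Finset.sum_sub_distrib, ← Finset.mul_sum, ← hJ] at h
      have h2 : 1 / Real.exp 1 * ∑ t ∈ Finset.range (Q * K), f t u ≤ R + J := by linarith
      rwa [one_div, inv_mul_le_iff₀ hexp] at h2
    rw [sub_le_iff_le_add, one_div, inv_mul_le_iff₀ hexp]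
    exact hsup
  refine ⟨fun t ht => ?_, hmain, fun hKT hQT => hmain.trans ?_⟩
  · have hq : t / K < Q := (Nat.div_lt_iff_lt_mul hK).2 ht
    exact integrable_reward hrand hCbox (hfdiff t ht).continuousOn
      (fun t ht => (hsg t ht).measurable) hOmeas hOmem hq
  · set T : ℝ := ((Q * K : ℕ) : ℝ) with hTdef
    have hT1 : 1 ≤ T := by
      rw [hTdef]
      exact_mod_cast hT
    have hT0 : 0 < T := by linarith
    have e1 : (Q : ℝ) * (K : ℝ) ^ (2 / 3 : ℝ) = T ^ (4 / 5 : ℝ) := by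
      rw [hKT, hQT, ← Real.rpow_mul hT0.le, ← Real.rpow_add hT0]
      norm_num
    have e2 : √(Q : ℝ) * K = T ^ (4 / 5 : ℝ) := by
      rw [hKT, hQT, Real.sqrt_eq_rpow, ← Real.rpow_mul hT0.le, ← Real.rpow_add hT0]
      norm_num
    have e3 : (Q : ℝ) ≤ T ^ (4 / 5 : ℝ) := by
      rw [hQT]
      exact Real.rpow_le_rpow_of_exponent_le hT1 (by norm_num)
    calc _ = 2 * Metric.diam C * (constN G σ L₀ (radius C) + 1) * (Q * (K : ℝ) ^ (2 / 3 : ℝ))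
          + L₀ * radius C ^ 2 / 2 * Q + M₀ * (√(Q : ℝ) * K) := by ring
      _ ≤ 2 * Metric.diam C * (constN G σ L₀ (radius C) + 1) * T ^ (4 / 5 : ℝ)
          + L₀ * radius C ^ 2 / 2 * T ^ (4 / 5 : ℝ) + M₀ * T ^ (4 / 5 : ℝ) := by
        rw [e1, e2]
        gcongr
      _ = _ := by ring
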